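/- Consider the position-based model (PBM) with $K$ arms and $L$ positions, $1\le L\le K$: parameters $1>\theta_1>\dots>\theta_K>0$ and known examination probabilities $1\ge\kappa_1>\dots>\kappa_L>0$. At round $t$ the learner shows a list $A(t)=(A_1(t),\dots,A_L(t))$ of distinct arms and observes $Z_l(t)=X_l(t)Y_l(t)$, $l\le L$, where, given the past and $A(t)$, the variables $X_l(t)\sim\mathcal B(\theta_{A_l(t)})$ and $Y_l(t)\sim\mathcal B(\kappa_l)$ are independent Bernoulli variables. Put $\mu_a=\sum_{l}\kappa_l\theta_{a_l}$, $a^*=(1,\dots,L)$, $\Delta_a=\mu_{a^*}-\mu_a$ and $\mathbb E[R(T)]=\mathbb E[\sum_{t=1}^T\Delta_{A(t)}]$. Let $d(p,q)$ be the Kullback–Leibler divergence from $\mathcal B(p)$ to $\mathcal B(q)$. At the start of round $t$, let $N_{k,l}(t)$ be the number of earlier rounds in which arm $k$ was shown at position $l$, $S_{k,l}(t)$ the number of those in which $Z_l=1$, and $\hat\theta_k(t)=\sum_l S_{k,l}(t)/\sum_l\kappa_lN_{k,l}(t)$. Let $\Phi_{k,t}(q)=\sum_l N_{k,l}(t)\,d(S_{k,l}(t)/N_{k,l}(t),\kappa_lq)$,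 let $\theta^{\min}_k(t)$ be its minimizer on $[0,1]$, and let $U_k(t,\delta)=\sup\{q\in[\theta_k^{\min}(t),1]:\Phi_{k,t}(q)\le\delta\}$ (equal to $\theta_k^{\min}(t)$ if there is no such $q$). PBM-PIE with parameter $\varepsilon>0$ is the following algorithm. In the first $K$ rounds it plays lists of distinct arms such that each arm is shown once at every position. At each round $t>K$ it computes the list $\mathcal L(t)$ of the $L$ arms with the largest $\hat\theta_k(t)$, in decreasing order (ties broken arbitrarily), and the set $\mathcal B(t)$ of the arms $k\notin\mathcal L(t)$ with $U_k(t,(1+\varepsilon)\log t)\ge\hat\theta_{\mathcal L_L(t)}(t)$. It plays $A_l(t)=\mathcal L_l(t)$ for $l<L$. If $\mathcal B(t)\ne\emptyset$, then with probability $1/2$ it takes $A_L(t)$ uniformly at random in $\mathcal B(t)$; otherwise $A_L(t)=\mathcal L_L(t)$. (1) There are functions $C_1(\eta)$, $C_2(\varepsilon,\eta)$, $C_3(\varepsilon)$ and $\beta(\varepsilon,\eta)$, depending on the problem $(K,L,\kappa,\theta)$, such that for all $\varepsilon>0$ and all $\eta$ with $0<\eta<\min_{k<K}(\theta_k-\theta_{k+1})/2$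 one has $\beta(\varepsilon,\eta)>0$ and, for all $T\ge1$, PBM-PIE with parameter $\varepsilon$ satisfies \[ \mathbb E[R(T)]\le(1+\varepsilon)^2\log(T)\sum_{k=L+1}^K\frac{\kappa_L(\theta_L-\theta_k)}{d(\kappa_L\theta_k,\kappa_L(\theta_L-\eta))}+C_1(\eta)+\frac{C_2(\varepsilon,\eta)}{T^{\beta(\varepsilon,\eta)}}+C_3(\varepsilon). \] (2) Let $v_{k,l}=(1,\dots,l-1,k,l,\dots,L-1)$. If for every $k>L$ the minimum over $l\in\{1,\dots,L\}$ of $\Delta_{v_{k,l}}/d(\kappa_l\theta_k,\kappa_l\theta_L)$ is attained at $l=L$, then for every $\varepsilon>0$ PBM-PIE with parameter $\varepsilon$ satisfies \[ \limsup_{T\to\infty}\frac{\mathbb E[R(T)]}{\log T}\le(1+\varepsilon)^2\sum_{k=L+1}^K\min_{1\le l\le L}\frac{\Delta_{v_{k,l}}}{d(\kappa_l\theta_k,\kappa_l\theta_L)}, \] that is, up to the factor $(1+\varepsilon)^2$, its regret has the growth rate of the asymptotic lower bound for uniformly efficient algorithms. -/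

import Mathlib

open Filter
open scoped ENNReal

noncomputable section

namespace PBM

/-- The law of a vector with independent coordinates, the `i`-th one having law `p i`. -/
def piPMF {ι α : Type} [Fintype ι] [DecidableEq ι] [Fintype α] (p : ι → PMF α) :
    PMF (ι → α) :=
  PMF.ofFintype (fun z => ∏ i, p i (z i)) (by
    rw [← Fintype.prod_sum]
    refine Finset.prod_eq_one fun i _ => ?_
    have h := (p i).tsum_coe
    rwa [tsum_fintype] at h)

/-- The Bernoulli law `B(p)` on `Bool`. -/
def bern (p : ℝ) (h0 : 0 ≤ p) (h1 : p ≤ 1) : PMF Bool :=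
  PMF.ofFintype (fun b => ENNReal.ofReal (cond b p (1 - p))) (by
    rw [Fintype.sum_bool, cond_true, cond_false, ← ENNReal.ofReal_add h0 (by linarith)]
    simp)

/-- A position-based model with `K` arms and `L` positions: `θ k` is the attractiveness of
arm `k`, `κ l` is the probability that position `l` is examined; both are decreasing.
Arms and positions are numbered from `0` here. -/
structure Model (K L : ℕ) where
  θ : Fin K → ℝ
  κ : Fin L → ℝ
  θ_pos : ∀ k, 0 < θ k
  θ_lt_one : ∀ k, θ k < 1
  θ_anti : StrictAnti θ
  κ_pos : ∀ l, 0 < κ l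
  κ_le_one : ∀ l, κ l ≤ 1
  κ_anti : StrictAnti κ

/-- A list of arms, one for each position. The algorithm below only plays injective lists. -/
abbrev Action (K L : ℕ) : Type := Fin L → Fin K

/-- What the learner records in one round: the action and the censored feedback `Z`. -/
abbrev Obs (K L : ℕ) : Type := Action K L × (Fin L → Bool)

/-- The record of `n` rounds. -/
abbrev Hist (K L n : ℕ) : Type := Fin n → Obs K L

/-- A (randomized) policy: the conditional law of the next action given the record. -/
abbrev Policy (K L : ℕ) : Type := (n : ℕ) → Hist K L n → PMF (Action K L)

variable {K L n : ℕ}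

/-- Given the action `a`, the law of `Z = (X_l Y_l)_l`, with independent examinations
`Y_l ∼ B(κ_l)` and independent attractions `X_l ∼ B(θ_{a_l})`. -/
def Model.feedback (M : Model K L) (a : Action K L) : PMF (Fin L → Bool) :=
  piPMF fun l =>
    (bern (M.κ l) (M.κ_pos l).le (M.κ_le_one l)).bind fun y =>
      (bern (M.θ (a l)) (M.θ_pos _).le (M.θ_lt_one _).le).map fun x => x && y

/-- The law of the record of the first `n` rounds when policy `π` is run in the model `M`. -/
def Model.law (M : Model K L) (π : Policy K L) : (n : ℕ) → PMF (Hist K L n)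
  | 0 => PMF.pure Fin.elim0
  | n + 1 => (M.law π n).bind fun h =>
      (π n h).bind fun a =>
        (M.feedback a).map fun z => Fin.snoc (α := fun _ => Obs K L) h (a, z)

/-- The expected reward of an action. -/
def Model.mean (M : Model K L) (a : Action K L) : ℝ := ∑ l, M.κ l * M.θ (a l)

/-- The optimal action `(1, …, L)`. -/
def optAction (hLK : L ≤ K) : Action K L := fun l => Fin.castLE hLK l

/-- The gap of an action. -/
def Model.gap (M : Model K L) (hLK : L ≤ K) (a : Action K L) : ℝ :=
  M.mean (optAction hLK) - M.mean a

/-- The expected regret after `T` rounds, `𝔼[∑_{t ≤ T} Δ_{A(t)}]`. -/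
def Model.expRegret (M : Model K L) (hLK : L ≤ K) (π : Policy K L) (T : ℕ) : ℝ :=
  ∑ h : Hist K L T, (M.law π T h).toReal * ∑ s, M.gap hLK (h s).1

/-! ### Statistics available to the learner -/

/-- `N_{k,l}`: how often arm `k` was shown at position `l`. -/
def count (h : Hist K L n) (k : Fin K) (l : Fin L) : ℕ :=
  ∑ s, if (h s).1 l = k then 1 else 0

/-- `S_{k,l}`: how many positive feedbacks arm `k` received at position `l`. -/
def clicks (h : Hist K L n) (k : Fin K) (l : Fin L) : ℕ :=
  ∑ s, if (h s).1 l = k ∧ (h s).2 l = true then 1 else 0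

/-- The estimator `S_k / Ñ_k` of `θ_k`, with `Ñ_k = ∑_l κ_l N_{k,l}`. -/
def estimate (κ : Fin L → ℝ) (h : Hist K L n) (k : Fin K) : ℝ :=
  (∑ l, (clicks h k l : ℝ)) / ∑ l, κ l * (count h k l : ℝ)

/-- The Kullback-Leibler divergence from `B(p)` to `B(q)`, for `0 ≤ p ≤ 1` and `0 < q < 1`. -/
def kl (p q : ℝ) : ℝ := p * Real.log (p / q) + (1 - p) * Real.log ((1 - p) / (1 - q))

/-- The same divergence for all `p, q ∈ [0,1]`: it is infinite if `B(p)` is not absolutely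
continuous with respect to `B(q)`. -/
def klTop (p q : ℝ) : ℝ≥0∞ :=
  open Classical in
  if (q = 0 ∧ p ≠ 0) ∨ (q = 1 ∧ p ≠ 1) then ⊤ else ENNReal.ofReal (kl p q)

/-- `Φ(q) = ∑_l N_{k,l} d(S_{k,l} / N_{k,l}, κ_l q)`. -/
def divergence (κ : Fin L → ℝ) (h : Hist K L n) (k : Fin K) (q : ℝ) : ℝ≥0∞ :=
  ∑ l, (count h k l : ℝ≥0∞) * klTop ((clicks h k l : ℝ) / (count h k l : ℝ)) (κ l * q)

/-- The point of `[0,1]` at which the convex function `Φ` is minimal (it is unique as soon as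
arm `k` has been shown). -/
def thetaMin (κ : Fin L → ℝ) (h : Hist K L n) (k : Fin K) : ℝ :=
  sInf {q | q ∈ Set.Icc (0 : ℝ) 1 ∧
    ∀ r ∈ Set.Icc (0 : ℝ) 1, divergence κ h k q ≤ divergence κ h k r}

/-- The index `U_k(δ) = sup {q ∈ [θ_min, 1] | Φ(q) ≤ δ}`. The supremum is taken in the interval
`[θ_min, 1]`: it equals `θ_min` if no `q` satisfies the constraint. -/
def index (κ : Fin L → ℝ) (h : Hist K L n) (k : Fin K) (δ : ℝ) : ℝ :=
  sSup (insert (thetaMin κ h k)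
    {q | q ∈ Set.Icc (thetaMin κ h k) 1 ∧ divergence κ h k q ≤ ENNReal.ofReal δ})

/-! ### The algorithm -/

/-- The last position. -/
def lastPos (hL : 1 ≤ L) : Fin L := ⟨L - 1, by omega⟩

/-- An initialization: `K` lists of distinct arms that show each arm once at every position. -/
def IsInit (init : Fin K → Action K L) : Prop :=
  (∀ t, Function.Injective (init t)) ∧ ∀ l, Function.Bijective fun t => init t l

/-- `lead` returns the `L` arms with the largest estimates, by decreasing estimates; ties may be
broken in any way. -/
def IsLeaderRule (κ : Fin L → ℝ) (lead : (n : ℕ) → Hist K L n → Action K L) : Prop :=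
  ∀ (n : ℕ) (h : Hist K L n),
    Function.Injective (lead n h) ∧
    (∀ i j, i < j → estimate κ h (lead n h j) ≤ estimate κ h (lead n h i)) ∧
    ∀ k, k ∉ Set.range (lead n h) → ∀ l, estimate κ h k ≤ estimate κ h (lead n h l)

/-- The arms that are not leaders and whose index is at least the estimate of the last leader. -/
def candidates (hL : 1 ≤ L) (κ : Fin L → ℝ) (h : Hist K L n) (leaders : Action K L) (δ : ℝ) :
    Finset (Fin K) :=
  open Classical in
  Finset.univ.filter fun k =>
    k ∉ Set.range leaders ∧ estimate κ h (leaders (lastPos hL)) ≤ index κ h k δ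

/-- PBM-PIE. After `n` rounds the next round is `t = n + 1`. In the first `K` rounds the
initialization is played. Then the leaders are shown, except that, if there are candidates, the
last leader is replaced with probability `1/2` by a candidate drawn uniformly at random. The
exploration threshold is `δ = (1 + ε) log t`. -/
def pbmPie (hL : 1 ≤ L) (κ : Fin L → ℝ) (ε : ℝ) (init : Fin K → Action K L)
    (lead : (n : ℕ) → Hist K L n → Action K L) : Policy K L := fun n h =>
  if hn : n < K then PMF.pure (init ⟨n, hn⟩)
  else
    open Classical in
    if hB : (candidates hL κ h (lead n h) ((1 + ε) * Real.log ((n : ℝ) + 1))).Nonempty then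
      (bern (1 / 2) (by norm_num) (by norm_num)).bind fun explore =>
        if explore = true then
          (PMF.uniformOfFinset _ hB).map fun k => Function.update (lead n h) (lastPos hL) k
        else PMF.pure (lead n h)
    else PMF.pure (lead n h)

/-! ### Exploring a suboptimal arm at a given position -/

/-- The action `v_{k,l} = (1, …, l-1, k, l, …, L-1)`. -/
def insertAction (hLK : L ≤ K) (k : Fin K) (l : Fin L) : Action K L := fun j =>
  if j < l then Fin.castLE hLK j
  else if j = l then k
  else ⟨j.val - 1, by omega⟩

/-- `Δ_{v_{k,l}} / d(κ_l θ_k, κ_l θ_L)`: the cost of exploring arm `k > L` at position `l`. -/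
def Model.exploreCost (M : Model K L) (hL : 1 ≤ L) (hLK : L ≤ K) (k : Fin K) (l : Fin L) : ℝ :=
  M.gap hLK (insertAction hLK k l) /
    kl (M.κ l * M.θ k) (M.κ l * M.θ (Fin.castLE hLK (lastPos hL)))

end PBM

end

/-! Regret is charged round by round. If the leaders form the optimal list, only exploring an arm k
> L in the last position costs anything, namely κ_L(θ_L − θ_k). Such an arm is a candidate only if
its index reaches the estimate of arm L, hence, unless that estimate is off by η/2, only if its
index exceeds x = θ_L − η. This happens at about (1+ε)² log T / d(κ_L θ_k, κ_L x) showings: one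
factor 1+ε comes from the threshold, the other pays for replacing the empirical frequency by the
true one (`exists_sum_playProb_index_le`).

If the leaders form another list, either some leader is badly estimated, and it is shown with
probability at least 1/2, or some arm k ≤ L outside the list is badly estimated while the estimate
of the last leader is at most θ_k (`exists_bad_arm`). In the latter case, unless the confidence
bound of k fails, U_k ≥ θ_k makes k a candidate, shown with probability at least 1/(2K). So wrong
leaders are paid for by showings of badly estimated arms and by failures of confidence bounds
(`one_le_of_lead_ne`). Both have bounded expected total.

Showings of badly estimated arms: for a score with negative drift and small t > 0, exp(t · score) is
a supermartingale that loses on average a fixed fraction of its value whenever the arm is shown at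
the given position. Telescoping bounds the sum over rounds of (probability of showing) · exp(t ·
score), for every policy and without a union bound over counts
(`exists_sum_playProb_mul_exp_score_le`). A deviation is the event that such a score is nonnegative.

Failures of confidence bounds: Φ(q) is the logarithm of the maximal likelihood over the likelihood
at q. Likelihood ratios against fixed click probabilities have expectation at most 1. A grid of
O(log n) parameters per position dominates the power ρ < 1 of the maximal ratio (`exists_grid`), so
P(Φ(θ_k) > δ) is at most e^{−ρδ} times a power of log n, which is summable for δ = (1+ε) log t when
ρ(1+ε) > 1.

Part (2) follows by dividing by log T and letting η tend to 0. -/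

noncomputable section

namespace PBM

variable {K L n : ℕ}

/-! ### Expectations over finite types -/

/-- The expectation of `f` under the law `p` on a finite type. -/
def expect {α : Type} [Fintype α] (p : PMF α) (f : α → ℝ) : ℝ := ∑ a, (p a).toReal * f a

section Expect

variable {α β : Type} [Fintype α] [Fintype β]

theorem sum_toReal_eq_one (p : PMF α) : ∑ a, (p a).toReal = 1 := by
  rw [← ENNReal.toReal_sum fun a _ => p.apply_ne_top a, ← tsum_fintype (L := .unconditional _),
    p.tsum_coe, ENNReal.toReal_one]

theorem expect_const (p : PMF α) (c : ℝ) : expect p (fun _ => c) = c := by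
  rw [expect, ← Finset.sum_mul, sum_toReal_eq_one, one_mul]

theorem expect_mono {p : PMF α} {f g : α → ℝ} (h : ∀ a, f a ≤ g a) : expect p f ≤ expect p g :=
  Finset.sum_le_sum fun a _ => mul_le_mul_of_nonneg_left (h a) ENNReal.toReal_nonneg

theorem expect_nonneg {p : PMF α} {f : α → ℝ} (h : ∀ a, 0 ≤ f a) : 0 ≤ expect p f :=
  Finset.sum_nonneg fun a _ => mul_nonneg ENNReal.toReal_nonneg (h a)

theorem expect_add (p : PMF α) (f g : α → ℝ) :
    expect p (fun a => f a + g a) = expect p f + expect p g := by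
  simp [expect, mul_add, Finset.sum_add_distrib]

theorem expect_const_mul (p : PMF α) (c : ℝ) (f : α → ℝ) :
    expect p (fun a => c * f a) = c * expect p f := by
  simp only [expect, Finset.mul_sum]
  exact Finset.sum_congr rfl fun a _ => by ring

theorem expect_mul_const (p : PMF α) (c : ℝ) (f : α → ℝ) :
    expect p (fun a => f a * c) = expect p f * c := by
  simp only [expect, Finset.sum_mul]
  exact Finset.sum_congr rfl fun a _ => by ring

theorem expect_sum {ι : Type*} (s : Finset ι) (p : PMF α) (f : ι → α → ℝ) :
    expect p (fun a => ∑ i ∈ s, f i a) = ∑ i ∈ s, expect p (f i) := by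
  simp only [expect, Finset.mul_sum]
  exact Finset.sum_comm

theorem expect_pure (a : α) (f : α → ℝ) : expect (PMF.pure a) f = f a := by
  classical
  rw [expect, Finset.sum_eq_single a]
  · simp
  · intro b _ hb
    simp [PMF.pure_apply, hb]
  · simp

theorem expect_bind (p : PMF α) (q : α → PMF β) (f : β → ℝ) :
    expect (p.bind q) f = expect p fun a => expect (q a) f := by
  have h (b : β) : (p.bind q b).toReal = ∑ a, (p a).toReal * (q a b).toReal := by
    rw [PMF.bind_apply, tsum_fintype, ENNReal.toReal_sum]
    · simp
    · exact fun a _ => ENNReal.mul_ne_top (p.apply_ne_top a) ((q a).apply_ne_top b)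
  simp only [expect, h, Finset.sum_mul, Finset.mul_sum]
  rw [Finset.sum_comm]
  exact Finset.sum_congr rfl fun a _ => Finset.sum_congr rfl fun b _ => by ring

theorem expect_map (p : PMF α) (g : α → β) (f : β → ℝ) :
    expect (p.map g) f = expect p fun a => f (g a) := by
  simp [PMF.map, expect_bind, expect_pure]

theorem expect_uniformOfFinset (s : Finset α) (hs : s.Nonempty) (f : α → ℝ) :
    expect (PMF.uniformOfFinset s hs) f = (s.card : ℝ)⁻¹ * ∑ a ∈ s, f a := by
  classical
  have h : ∀ a, ((PMF.uniformOfFinset s hs) a).toReal * f a =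
      if a ∈ s then (s.card : ℝ)⁻¹ * f a else 0 := by
    intro a
    rw [PMF.uniformOfFinset_apply]
    split_ifs <;> simp
  simp only [expect, h]
  rw [Finset.sum_ite_mem, Finset.univ_inter, Finset.mul_sum]

theorem expect_bern {p : ℝ} (h0 : 0 ≤ p) (h1 : p ≤ 1) (f : Bool → ℝ) :
    expect (bern p h0 h1) f = p * f true + (1 - p) * f false := by
  simp [expect, bern, h0, h1]

theorem expect_piPMF {ι : Type} [Fintype ι] [DecidableEq ι] (p : ι → PMF α) (f : ι → α → ℝ) :
    expect (piPMF p) (fun z => ∏ i, f i (z i)) = ∏ i, expect (p i) (f i) := by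
  simp only [expect, Fintype.prod_sum, piPMF, PMF.ofFintype_apply, ENNReal.toReal_prod,
    Finset.prod_mul_distrib]

end Expect

/-! ### Running a policy -/

/-- The expectation of a function of the record of the first `n` rounds. -/
def Model.expectHist (M : Model K L) (π : Policy K L) (n : ℕ) (f : Hist K L n → ℝ) : ℝ :=
  expect (M.law π n) f

/-- The probability that `π` shows arm `k` at position `l` in the next round. -/
def playProb (π : Policy K L) (h : Hist K L n) (l : Fin L) (k : Fin K) : ℝ :=
  expect (π n h) fun a => if a l = k then 1 else 0

theorem playProb_nonneg (π : Policy K L) (h : Hist K L n) (l : Fin L) (k : Fin K) :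
    0 ≤ playProb π h l k :=
  expect_nonneg fun a => by split_ifs <;> norm_num

theorem playProb_le_one (π : Policy K L) (h : Hist K L n) (l : Fin L) (k : Fin K) :
    playProb π h l k ≤ 1 :=
  (expect_mono fun a => by split_ifs <;> norm_num).trans_eq (expect_const _ 1)

/-- The record `h` followed by a round with action `a` and feedback `z`. -/
abbrev extend (h : Hist K L n) (a : Action K L) (z : Fin L → Bool) : Hist K L (n + 1) :=
  Fin.snoc (α := fun _ => Obs K L) h (a, z)

theorem Model.expectHist_succ (M : Model K L) (π : Policy K L) (n : ℕ)
    (f : Hist K L (n + 1) → ℝ) :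
    M.expectHist π (n + 1) f = M.expectHist π n fun h =>
      expect (π n h) fun a => expect (M.feedback a) fun z => f (extend h a z) := by
  simp only [Model.expectHist, Model.law, expect_bind, expect_map]

theorem Model.expectHist_zero (M : Model K L) (π : Policy K L) (f : Hist K L 0 → ℝ) :
    M.expectHist π 0 f = f Fin.elim0 := by
  simp only [Model.expectHist, Model.law, expect_pure]

theorem Model.expRegret_eq_sum (M : Model K L) (hLK : L ≤ K) (π : Policy K L) (T : ℕ) :
    M.expRegret hLK π T =
      ∑ n ∈ Finset.range T, M.expectHist π n fun h => expect (π n h) (M.gap hLK) := by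
  change M.expectHist π T (fun h => ∑ s, M.gap hLK (h s).1) = _
  induction T with
  | zero => simp [Model.expectHist_zero]
  | succ T ih =>
    rw [Finset.sum_range_succ, ← ih, Model.expectHist_succ, Model.expectHist, Model.expectHist,
      Model.expectHist, ← expect_add]
    congr 1
    funext h
    simp only [extend, Fin.sum_univ_castSucc, Fin.snoc_castSucc, Fin.snoc_last, expect_const,
      expect_add]

/-- A nonnegative potential that decreases on average by at least `r` pays for the total
expectation of `r`. -/
theorem Model.sum_expectHist_le_of_potential (M : Model K L) (π : Policy K L)
    (V : ∀ n, Hist K L n → ℝ) (r : ∀ n, Hist K L n → Action K L → ℝ)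
    (hV : ∀ n h, 0 ≤ V n h)
    (hstep : ∀ n h a, expect (M.feedback a) (fun z => V (n + 1) (extend h a z)) ≤
      V n h - r n h a) (T : ℕ) :
    ∑ n ∈ Finset.range T, M.expectHist π n (fun h => expect (π n h) (r n h)) ≤
      V 0 Fin.elim0 := by
  -- The induction keeps the expected remaining potential on the left; it is dropped at the end,
  -- being nonnegative.
  have key : ∑ n ∈ Finset.range T, M.expectHist π n (fun h => expect (π n h) (r n h)) +
      M.expectHist π T (V T) ≤ V 0 Fin.elim0 := by
    induction T with
    | zero => simp [Model.expectHist_zero]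
    | succ T ih =>
      refine le_trans ?_ ih
      rw [Finset.sum_range_succ, add_assoc, Model.expectHist_succ]
      refine add_le_add le_rfl ?_
      unfold Model.expectHist
      rw [← expect_add]
      refine expect_mono fun h => ?_
      rw [← expect_add]
      refine (expect_mono fun a => ?_).trans_eq (expect_const (π T h) (V T h))
      linarith [hstep T h a]
  have := expect_nonneg (p := M.law π T) (hV T)
  unfold Model.expectHist at key ⊢
  linarith

/-! ### Multiplicative weights of an arm -/

theorem Model.prob_pos (M : Model K L) (k : Fin K) (l : Fin L) : 0 < M.κ l * M.θ k :=
  mul_pos (M.κ_pos l) (M.θ_pos k)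

theorem Model.prob_lt_one (M : Model K L) (k : Fin K) (l : Fin L) : M.κ l * M.θ k < 1 := by
  nlinarith [M.κ_pos l, M.κ_le_one l, M.θ_pos k, M.θ_lt_one k]

theorem Model.expect_feedback (M : Model K L) (a : Action K L) (f : Fin L → Bool → ℝ) :
    expect (M.feedback a) (fun z => ∏ l, f l (z l)) =
      ∏ l, (M.κ l * M.θ (a l) * f l true + (1 - M.κ l * M.θ (a l)) * f l false) := by
  rw [Model.feedback, expect_piPMF]
  refine Finset.prod_congr rfl fun l _ => ?_
  rw [expect_bind, expect_bern]
  simp only [expect_map, expect_bern]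
  simp
  ring

/-- The product of `f l z` over all the times arm `k` was shown, at position `l` with
feedback `z`. -/
def weight (f : Fin L → Bool → ℝ) (k : Fin K) (h : Hist K L n) : ℝ :=
  ∏ s, ∏ l, if (h s).1 l = k then f l ((h s).2 l) else 1

theorem weight_extend (f : Fin L → Bool → ℝ) (k : Fin K) (h : Hist K L n) (a : Action K L)
    (z : Fin L → Bool) :
    weight f k (extend h a z) = weight f k h * ∏ l, if a l = k then f l (z l) else 1 := by
  simp only [weight, extend, Fin.prod_univ_castSucc, Fin.snoc_castSucc, Fin.snoc_last]

theorem weight_nonneg {f : Fin L → Bool → ℝ} (hf : ∀ l z, 0 ≤ f l z) (k : Fin K)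
    (h : Hist K L n) : 0 ≤ weight f k h :=
  Finset.prod_nonneg fun s _ => Finset.prod_nonneg fun l _ => by
    split_ifs
    exacts [hf _ _, zero_le_one]

theorem clicks_le_count (h : Hist K L n) (k : Fin K) (l : Fin L) :
    clicks h k l ≤ count h k l :=
  Finset.sum_le_sum fun s _ => by split_ifs <;> simp_all

theorem count_le (h : Hist K L n) (k : Fin K) (l : Fin L) : count h k l ≤ n :=
  (Finset.sum_le_sum (g := fun _ => 1) fun s _ => by split_ifs <;> simp).trans (by simp)

theorem weight_eq (f : Fin L → Bool → ℝ) (k : Fin K) (h : Hist K L n) :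
    weight f k h =
      ∏ l, f l true ^ clicks h k l * f l false ^ (count h k l - clicks h k l) := by
  rw [weight, Finset.prod_comm]
  refine Finset.prod_congr rfl fun l _ => ?_
  have hc : count h k l - clicks h k l =
      ∑ s, if (h s).1 l = k ∧ (h s).2 l = false then 1 else 0 := by
    rw [Nat.sub_eq_iff_eq_add (clicks_le_count h k l), count, clicks, ← Finset.sum_add_distrib]
    refine Finset.sum_congr rfl fun s _ => ?_
    cases (h s).2 l <;> simp
  rw [hc, clicks, ← Finset.prod_pow_eq_pow_sum, ← Finset.prod_pow_eq_pow_sum,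
    ← Finset.prod_mul_distrib]
  refine Finset.prod_congr rfl fun s _ => ?_
  by_cases h1 : (h s).1 l = k <;> cases (h s).2 l <;> simp [h1]

theorem Model.expect_weight_extend (M : Model K L) (f : Fin L → Bool → ℝ) (k : Fin K)
    (h : Hist K L n) (a : Action K L) :
    expect (M.feedback a) (fun z => weight f k (extend h a z)) =
      weight f k h * ∏ l, if a l = k then
        M.κ l * M.θ k * f l true + (1 - M.κ l * M.θ k) * f l false else 1 := by
  simp only [weight_extend, expect_const_mul]
  rw [M.expect_feedback a fun l z => if a l = k then f l z else 1]
  congr 1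
  refine Finset.prod_congr rfl fun l _ => ?_
  split_ifs with hl
  · rw [hl]
  · ring

/-- The weight is a nonnegative supermartingale started at 1: the coordinates of the feedback are
independent, so a round multiplies it on average by a product of factors at most 1. -/
theorem Model.expectHist_weight_le_one (M : Model K L) (π : Policy K L)
    {f : Fin L → Bool → ℝ} (hf : ∀ l z, 0 ≤ f l z) (k : Fin K)
    (hm : ∀ l, M.κ l * M.θ k * f l true + (1 - M.κ l * M.θ k) * f l false ≤ 1) (n : ℕ) :
    M.expectHist π n (weight f k) ≤ 1 := by
  induction n with
  | zero => simp [Model.expectHist_zero, weight]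
  | succ n ih =>
    rw [Model.expectHist_succ]
    refine le_trans (expect_mono fun h => ?_) ih
    refine (expect_mono fun a => ?_).trans_eq (expect_const (π n h) (weight f k h))
    rw [M.expect_weight_extend]
    refine mul_le_of_le_one_right (weight_nonneg hf k h) (Finset.prod_le_one ?_ ?_) <;>
      intro l _ <;> split_ifs
    · have := M.prob_pos k l
      have := M.prob_lt_one k l
      exact add_nonneg (mul_nonneg (by linarith) (hf _ _)) (mul_nonneg (by linarith) (hf _ _))
    · exact zero_le_one
    · exact hm l
    · exact le_rfl

/-- Each showing of the arm at position `l₀` costs the supermartingale on average at least the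
fraction `c` of its value, and the total loss cannot exceed the initial value 1. -/
theorem Model.sum_playProb_mul_weight_le (M : Model K L) (π : Policy K L)
    {f : Fin L → Bool → ℝ} (hf : ∀ l z, 0 ≤ f l z) (k : Fin K)
    (hm : ∀ l, M.κ l * M.θ k * f l true + (1 - M.κ l * M.θ k) * f l false ≤ 1)
    (l₀ : Fin L) {c : ℝ} (hc : 0 < c)
    (hm₀ : M.κ l₀ * M.θ k * f l₀ true + (1 - M.κ l₀ * M.θ k) * f l₀ false ≤ 1 - c) (T : ℕ) :
    ∑ n ∈ Finset.range T, M.expectHist π n (fun h => playProb π h l₀ k * weight f k h) ≤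
      1 / c := by
  have hnn : ∀ l, 0 ≤ M.κ l * M.θ k * f l true + (1 - M.κ l * M.θ k) * f l false := fun l => by
    have := M.prob_pos k l
    have := M.prob_lt_one k l
    exact add_nonneg (mul_nonneg (by linarith) (hf _ _)) (mul_nonneg (by linarith) (hf _ _))
  have key := M.sum_expectHist_le_of_potential π (fun n h => weight f k h)
    (fun n h a => (if a l₀ = k then 1 else 0) * (c * weight f k h))
    (fun n h => weight_nonneg hf k h) (fun n h a => ?_) T
  · have h0 : weight f k (Fin.elim0 : Hist K L 0) = 1 := by simp [weight]
    rw [h0] at key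
    rw [le_div_iff₀ hc]
    refine le_trans (le_of_eq ?_) key
    rw [Finset.sum_mul]
    refine Finset.sum_congr rfl fun n _ => ?_
    simp only [Model.expectHist, expect_mul_const, playProb]
    rw [← expect_mul_const]
    congr 1
    funext h
    ring
  · rw [M.expect_weight_extend]
    have hW := weight_nonneg hf k h
    have hle : ∀ l, (if a l = k then
        M.κ l * M.θ k * f l true + (1 - M.κ l * M.θ k) * f l false else 1) ≤ 1 := fun l => by
      split_ifs
      exacts [hm l, le_rfl]
    have hge : ∀ l, 0 ≤ (if a l = k then
        M.κ l * M.θ k * f l true + (1 - M.κ l * M.θ k) * f l false else 1) := fun l => by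
      split_ifs
      exacts [hnn l, zero_le_one]
    have hprod : (∏ l, if a l = k then
        M.κ l * M.θ k * f l true + (1 - M.κ l * M.θ k) * f l false else 1) ≤
        1 - (if a l₀ = k then 1 else 0) * c := by
      rw [← Finset.mul_prod_erase _ _ (Finset.mem_univ l₀)]
      refine (mul_le_of_le_one_right (hge l₀)
        (Finset.prod_le_one (fun l _ => hge l) fun l _ => hle l)).trans ?_
      split_ifs <;> linarith
    nlinarith

/-! ### Exponential moments of additive scores. -/

theorem eventually_expect_exp_lt_one {p a b : ℝ} (h : p * a + (1 - p) * b < 0) :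
    ∀ᶠ t in nhdsWithin (0 : ℝ) (Set.Ioi 0),
      p * Real.exp (t * a) + (1 - p) * Real.exp (t * b) < 1 := by
  -- At t = 0 the function equals 1 and its slope is the mean, which is negative.
  have hd : HasDerivAt (fun t : ℝ => p * Real.exp (t * a) + (1 - p) * Real.exp (t * b))
      (p * a + (1 - p) * b) 0 := by
    have h1 : ∀ c : ℝ, HasDerivAt (fun t : ℝ => Real.exp (t * c)) c 0 := fun c => by
      simpa using ((hasDerivAt_id (0 : ℝ)).mul_const c).exp
    exact ((h1 a).const_mul p).add ((h1 b).const_mul (1 - p))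
  have hs := (hasDerivAt_iff_tendsto_slope.1 hd).eventually (gt_mem_nhds h)
  have hs' := hs.filter_mono (nhdsWithin_mono 0 (s := Set.Ioi 0) fun x hx => ne_of_gt hx)
  filter_upwards [hs', self_mem_nhdsWithin] with t ht ht0
  rw [slope_def_field] at ht
  have ht0' : (0 : ℝ) < t := ht0
  rw [div_neg_iff] at ht
  rcases ht with ht | ht
  · linarith
  · have := ht.1
    simp only [zero_mul, Real.exp_zero] at this
    linarith

/-- The total score of arm `k` when a click at position `l` is worth `a l` and its absence is
worth `b l`. -/
def score (a b : Fin L → ℝ) (k : Fin K) (h : Hist K L n) : ℝ :=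
  ∑ l, ((clicks h k l : ℝ) * a l + ((count h k l : ℝ) - clicks h k l) * b l)

theorem exp_score (t : ℝ) (a b : Fin L → ℝ) (k : Fin K) (h : Hist K L n) :
    Real.exp (t * score a b k h) =
      weight (fun l z => Real.exp (t * cond z (a l) (b l))) k h := by
  rw [weight_eq, score, Finset.mul_sum, Real.exp_sum]
  refine Finset.prod_congr rfl fun l _ => ?_
  rw [← Real.exp_nat_mul, ← Real.exp_nat_mul, ← Real.exp_add,
    Nat.cast_sub (clicks_le_count h k l)]
  congr 1
  simp only [cond_true, cond_false]
  ring

/-- A score of negative mean is rarely large at the rounds in which it is updated. -/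
theorem Model.exists_sum_playProb_mul_exp_score_le (M : Model K L) (k : Fin K)
    (a b : Fin L → ℝ)
    (hab : ∀ l, (a l = 0 ∧ b l = 0) ∨
      M.κ l * M.θ k * a l + (1 - M.κ l * M.θ k) * b l < 0) (l₀ : Fin L)
    (h₀ : M.κ l₀ * M.θ k * a l₀ + (1 - M.κ l₀ * M.θ k) * b l₀ < 0) :
    ∃ t > 0, ∃ C ≥ 0, ∀ (π : Policy K L) (T : ℕ),
      ∑ n ∈ Finset.range T, M.expectHist π n
        (fun h => playProb π h l₀ k * Real.exp (t * score a b k h)) ≤ C := by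
  -- A single t must serve every position; there are finitely many conditions, each valid for all
  -- small t > 0.
  have hev : ∀ᶠ t in nhdsWithin (0 : ℝ) (Set.Ioi 0), 0 < t ∧
      (∀ l, M.κ l * M.θ k * Real.exp (t * a l) +
        (1 - M.κ l * M.θ k) * Real.exp (t * b l) ≤ 1) ∧
      M.κ l₀ * M.θ k * Real.exp (t * a l₀) +
        (1 - M.κ l₀ * M.θ k) * Real.exp (t * b l₀) < 1 := by
    refine Filter.Eventually.and self_mem_nhdsWithin (Filter.Eventually.and ?_
      (eventually_expect_exp_lt_one h₀))
    refine Filter.eventually_all.2 fun l => ?_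
    rcases hab l with ⟨h1, h2⟩ | h
    · exact Filter.Eventually.of_forall fun t => by simp [h1, h2]
    · exact (eventually_expect_exp_lt_one h).mono fun t ht => ht.le
  obtain ⟨t, ht, hle, hlt⟩ := hev.exists
  refine ⟨t, ht, 1 / (1 - (M.κ l₀ * M.θ k * Real.exp (t * a l₀) +
        (1 - M.κ l₀ * M.θ k) * Real.exp (t * b l₀))), ?_, fun π T => ?_⟩
  · have := sub_pos.2 hlt
    positivity
  · simp only [exp_score]
    exact M.sum_playProb_mul_weight_le π (fun l z => (Real.exp_pos _).le) k hle l₀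
      (sub_pos.2 hlt) (by simp) T

/-- An arm is shown at most `x + 1` times while it has been shown less than `x` times. -/
theorem Model.sum_playProb_count_lt_le (M : Model K L) (π : Policy K L) (k : Fin K) (l : Fin L)
    {x : ℝ} (hx : 0 ≤ x) (T : ℕ) :
    ∑ n ∈ Finset.range T, M.expectHist π n
      (fun h => playProb π h l k * (if (count h k l : ℝ) < x then 1 else 0)) ≤ x + 1 := by
  -- The shift by 1 makes the potential drop by exactly 1 at each showing with count below `x`:
  -- truncation at 0 does not yet act.
  have key := M.sum_expectHist_le_of_potential π
    (fun n h => max 0 (x + 1 - (count h k l : ℝ)))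
    (fun n h a => (if a l = k then 1 else 0) * (if (count h k l : ℝ) < x then 1 else 0))
    (fun n h => le_max_left _ _) (fun n h a => ?_) T
  · simp only [expect_mul_const] at key
    refine key.trans (max_le (by linarith) ?_)
    have : (0 : ℝ) ≤ count (Fin.elim0 : Hist K L 0) k l := Nat.cast_nonneg _
    linarith
  · have hc : ∀ z, count (extend h a z) k l = count h k l + if a l = k then 1 else 0 :=
      fun z => by
        simp only [count, extend, Fin.sum_univ_castSucc, Fin.snoc_castSucc, Fin.snoc_last]
    simp only [hc, expect_const]
    split_ifs with h1 h2
    · push_cast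
      rw [max_eq_right (by linarith), max_eq_right (by linarith)]
      linarith
    · push_cast
      rw [mul_zero, sub_zero]
      exact max_le_max le_rfl (by linarith)
    · simp
    · simp

/-! ### The Bernoulli divergence -/

/-- This is log u ≥ 1 − 1/u at u = p/q. Adding the cases (p, q) and (1−p, 1−q) gives the
nonnegativity of the divergence. -/
theorem sub_le_mul_log_div {p q : ℝ} (hp : 0 ≤ p) (hq : 0 ≤ q) (h : q = 0 → p = 0) :
    p - q ≤ p * Real.log (p / q) := by
  rcases hp.eq_or_lt with rfl | hp
  · simpa using hq
  · have hq' : 0 < q := hq.lt_of_ne fun h0 => hp.ne' (h h0.symm)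
    have := mul_le_mul_of_nonneg_left (Real.one_sub_inv_le_log_of_pos (div_pos hp hq')) hp.le
    rwa [inv_div, mul_sub, mul_one, mul_div_cancel₀ _ hp.ne'] at this

theorem kl_nonneg {p q : ℝ} (hp0 : 0 ≤ p) (hp1 : p ≤ 1) (hq0 : 0 ≤ q) (hq1 : q ≤ 1)
    (h0 : q = 0 → p = 0) (h1 : q = 1 → p = 1) : 0 ≤ kl p q := by
  have a := sub_le_mul_log_div hp0 hq0 h0
  have b := sub_le_mul_log_div (sub_nonneg.2 hp1) (sub_nonneg.2 hq1)
    fun h => by linarith [h1 (by linarith)]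
  unfold kl
  linarith

theorem kl_pos {p q : ℝ} (hp0 : 0 < p) (hp1 : p < 1) (hq0 : 0 < q) (hq1 : q < 1)
    (h : p ≠ q) : 0 < kl p q := by
  have a : p - q < p * Real.log (p / q) := by
    have hne : q / p ≠ 1 := fun h' => h ((div_eq_one_iff_eq hp0.ne').1 h').symm
    have hlog := Real.log_lt_sub_one_of_pos (div_pos hq0 hp0) hne
    rw [← inv_div, Real.log_inv]
    have := mul_lt_mul_of_pos_left hlog hp0
    rw [mul_sub, mul_div_cancel₀ _ hp0.ne'] at this
    linarith
  have b := sub_le_mul_log_div (sub_nonneg.2 hp1.le) (sub_nonneg.2 hq1.le) fun h => by linarith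
  unfold kl
  linarith

theorem continuousAt_kl_left {p q : ℝ} (hp0 : 0 < p) (hp1 : p < 1) (hq0 : 0 < q) (hq1 : q < 1) :
    ContinuousAt (fun x => kl x q) p := by
  unfold kl
  have h1 : p / q ≠ 0 := (div_pos hp0 hq0).ne'
  have h2 : (1 - p) / (1 - q) ≠ 0 := (div_pos (sub_pos.2 hp1) (sub_pos.2 hq1)).ne'
  exact (continuousAt_id.mul ((continuousAt_id.div_const q).log h1)).add
    ((continuousAt_const.sub continuousAt_id).mul
      (((continuousAt_const.sub continuousAt_id).div_const (1 - q)).log h2))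

theorem continuousAt_kl_right {p q : ℝ} (hp0 : 0 < p) (hp1 : p < 1) (hq0 : 0 < q)
    (hq1 : q < 1) : ContinuousAt (fun x => kl p x) q := by
  unfold kl
  have h1 : p / q ≠ 0 := (div_pos hp0 hq0).ne'
  have h2 : (1 - p) / (1 - q) ≠ 0 := (div_pos (sub_pos.2 hp1) (sub_pos.2 hq1)).ne'
  exact (continuousAt_const.mul ((continuousAt_const.div continuousAt_id hq0.ne').log h1)).add
    (continuousAt_const.mul
      ((continuousAt_const.div (continuousAt_const.sub continuousAt_id)
        (sub_pos.2 hq1).ne').log h2))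

/-! ### Bernoulli likelihoods -/

/-- The likelihood of `S` successes in `N` trials of `B(q)`, in a given order. -/
def bernLik (S N : ℕ) (q : ℝ) : ℝ := q ^ S * (1 - q) ^ (N - S)

/-- The largest likelihood of `S` successes in `N` trials. -/
def maxBernLik (S N : ℕ) : ℝ := bernLik S N ((S : ℝ) / N)

theorem freq_mem {S N : ℕ} (h : S ≤ N) : 0 ≤ (S : ℝ) / N ∧ (S : ℝ) / N ≤ 1 :=
  ⟨by positivity, div_le_one_of_le₀ (by exact_mod_cast h) (by positivity)⟩

theorem bernLik_nonneg {S N : ℕ} {q : ℝ} (h0 : 0 ≤ q) (h1 : q ≤ 1) : 0 ≤ bernLik S N q :=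
  mul_nonneg (pow_nonneg h0 _) (pow_nonneg (sub_nonneg.2 h1) _)

theorem bernLik_pos {S N : ℕ} {q : ℝ} (h0 : 0 < q) (h1 : q < 1) : 0 < bernLik S N q :=
  mul_pos (pow_pos h0 _) (pow_pos (sub_pos.2 h1) _)

theorem log_pow_mul_pow {x y : ℝ} {m k : ℕ} (h : x ^ m * y ^ k ≠ 0) :
    Real.log (x ^ m * y ^ k) = m * Real.log x + k * Real.log y := by
  rw [Real.log_mul (left_ne_zero_of_mul h) (right_ne_zero_of_mul h), Real.log_pow, Real.log_pow]

theorem maxBernLik_pos {S N : ℕ} (h : S ≤ N) : 0 < maxBernLik S N := by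
  have hf := freq_mem h
  have hne : maxBernLik S N ≠ 0 := by
    refine mul_ne_zero ?_ ?_
    · rcases Nat.eq_zero_or_pos S with rfl | hS
      · simp
      · have : 0 < N := hS.trans_le h
        positivity
    · rcases h.eq_or_lt with rfl | hlt
      · simp
      · have hN : (0 : ℝ) < N := by exact_mod_cast (Nat.zero_le S).trans_lt hlt
        have : (S : ℝ) / N < 1 := (div_lt_one hN).2 (by exact_mod_cast hlt)
        exact pow_ne_zero _ (sub_pos.2 this).ne'
  exact lt_of_le_of_ne (bernLik_nonneg hf.1 hf.2) (Ne.symm hne)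

/-- Turns divergences into log-likelihood ratios, so that later arguments can work with products.
Frequencies 0 and 1 need separate cases because of the convention for log 0. -/
theorem mul_kl_eq {S N : ℕ} (h : S ≤ N) {q : ℝ} (hq : bernLik S N q ≠ 0) :
    (N : ℝ) * kl ((S : ℝ) / N) q = Real.log (maxBernLik S N) - Real.log (bernLik S N q) := by
  have hm := (maxBernLik_pos h).ne'
  unfold maxBernLik bernLik at *
  rw [log_pow_mul_pow hm, log_pow_mul_pow hq]
  rcases Nat.eq_zero_or_pos N with rfl | hN
  · obtain rfl : S = 0 := by omega
    simp
  have hN' : (0 : ℝ) < N := by exact_mod_cast hN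
  have e1 : (N : ℝ) * ((S : ℝ) / N * Real.log ((S : ℝ) / N / q)) =
      S * Real.log ((S : ℝ) / N) - S * Real.log q := by
    rcases Nat.eq_zero_or_pos S with rfl | hS
    · simp
    · have hq0 : q ≠ 0 := fun h0 => left_ne_zero_of_mul hq (by rw [h0, zero_pow hS.ne'])
      have hS' : (0 : ℝ) < S := by exact_mod_cast hS
      rw [Real.log_div (by positivity) hq0]
      field_simp
  have e2 : (N : ℝ) * ((1 - (S : ℝ) / N) * Real.log ((1 - (S : ℝ) / N) / (1 - q))) =
      ((N - S : ℕ) : ℝ) * Real.log (1 - (S : ℝ) / N) -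
        ((N - S : ℕ) : ℝ) * Real.log (1 - q) := by
    have hc : (N : ℝ) * (1 - (S : ℝ) / N) = ((N - S : ℕ) : ℝ) := by
      rw [Nat.cast_sub h]
      field_simp
    rw [← mul_assoc, hc]
    rcases Nat.eq_zero_or_pos (N - S) with h0 | hS
    · simp [h0]
    · have hq0 : 1 - q ≠ 0 := fun h0 => right_ne_zero_of_mul hq (by rw [h0, zero_pow hS.ne'])
      have hS' : (1 : ℝ) - (S : ℝ) / N ≠ 0 := fun h0 =>
        right_ne_zero_of_mul hm (by rw [h0, zero_pow hS.ne'])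
      rw [Real.log_div hS' hq0]
      ring
  rw [kl, mul_add, e1, e2]
  ring

theorem degenerate_iff {S N : ℕ} (h : S ≤ N) (hN : 0 < N) {q : ℝ} :
    ((q = 0 ∧ (S : ℝ) / N ≠ 0) ∨ (q = 1 ∧ (S : ℝ) / N ≠ 1)) ↔ bernLik S N q = 0 := by
  have hN' : (N : ℝ) ≠ 0 := by positivity
  have e0 : (S : ℝ) / N ≠ 0 ↔ S ≠ 0 := by simp [hN.ne']
  have e1 : (S : ℝ) / N ≠ 1 ↔ N - S ≠ 0 := by
    rw [Ne, div_eq_one_iff_eq hN', Nat.cast_inj]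
    omega
  rw [e0, e1, bernLik, mul_eq_zero, pow_eq_zero_iff', pow_eq_zero_iff', sub_eq_zero,
    eq_comm (a := (1 : ℝ))]

theorem bernLik_le_maxBernLik {S N : ℕ} (h : S ≤ N) {q : ℝ} (h0 : 0 ≤ q) (h1 : q ≤ 1) :
    bernLik S N q ≤ maxBernLik S N := by
  rcases eq_or_ne (bernLik S N q) 0 with hz | hz
  · rw [hz]
    exact (maxBernLik_pos h).le
  rcases Nat.eq_zero_or_pos N with rfl | hN
  · obtain rfl : S = 0 := by omega
    simp [bernLik, maxBernLik]
  have hf := freq_mem h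
  have hd := (not_congr (degenerate_iff h hN)).2 hz
  push Not at hd
  have hk := mul_nonneg (Nat.cast_nonneg (α := ℝ) N) (kl_nonneg hf.1 hf.2 h0 h1 hd.1 hd.2)
  rw [mul_kl_eq h hz, sub_nonneg] at hk
  exact (Real.log_le_log_iff ((bernLik_nonneg h0 h1).lt_of_ne hz.symm) (maxBernLik_pos h)).1 hk

/-- Infinite divergence corresponds exactly to zero likelihood. Without any trial both sides are 0,
since 0 · ⊤ = 0 and the empty likelihood is 1. -/
theorem mul_klTop_eq {S N : ℕ} (h : S ≤ N) {q : ℝ} :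
    (N : ℝ≥0∞) * klTop ((S : ℝ) / N) q =
      if bernLik S N q = 0 then ⊤
      else ENNReal.ofReal (Real.log (maxBernLik S N) - Real.log (bernLik S N q)) := by
  rcases Nat.eq_zero_or_pos N with rfl | hN
  · obtain rfl : S = 0 := by omega
    simp [bernLik, maxBernLik]
  rw [klTop]
  simp only [degenerate_iff h hN]
  split_ifs with hz
  · exact ENNReal.mul_top (by exact_mod_cast hN.ne')
  · rw [← mul_kl_eq h hz, ENNReal.ofReal_mul (by positivity), ENNReal.ofReal_natCast]

/-- Likelihoods are log-concave. -/
theorem bernLik_rpow_mul_rpow_le {S N : ℕ} {u v r : ℝ} (hu0 : 0 ≤ u) (hu1 : u ≤ 1)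
    (hv0 : 0 ≤ v) (hv1 : v ≤ 1) (hr0 : 0 ≤ r) (hr1 : r ≤ 1) :
    bernLik S N u ^ (1 - r) * bernLik S N v ^ r ≤ bernLik S N ((1 - r) * u + r * v) := by
  -- Weighted arithmetic–geometric mean, for the pair u, v and for the pair 1 − u, 1 − v.
  have a := Real.geom_mean_le_arith_mean2_weighted (sub_nonneg.2 hr1) hr0 hu0 hv0 (by ring)
  have b := Real.geom_mean_le_arith_mean2_weighted (sub_nonneg.2 hr1) hr0 (sub_nonneg.2 hu1)
    (sub_nonneg.2 hv1) (by ring)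
  have hu1' := sub_nonneg.2 hu1
  have hv1' := sub_nonneg.2 hv1
  unfold bernLik
  rw [Real.mul_rpow (by positivity) (by positivity), Real.mul_rpow (by positivity) (by positivity),
    ← Real.rpow_pow_comm hu0, ← Real.rpow_pow_comm hv0, ← Real.rpow_pow_comm hu1',
    ← Real.rpow_pow_comm hv1']
  calc _ = (u ^ (1 - r) * v ^ r) ^ S * ((1 - u) ^ (1 - r) * (1 - v) ^ r) ^ (N - S) := by
        rw [mul_pow, mul_pow]; ring
    _ ≤ ((1 - r) * u + r * v) ^ S * ((1 - r) * (1 - u) + r * (1 - v)) ^ (N - S) := by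
        gcongr
    _ = _ := by congr 2; ring

/-! ### The likelihood of an arm -/

/-- The likelihood of the feedback about arm `k` when its attractiveness is `q`. -/
def armLik (κ : Fin L → ℝ) (h : Hist K L n) (k : Fin K) (q : ℝ) : ℝ :=
  ∏ l, bernLik (clicks h k l) (count h k l) (κ l * q)

/-- The largest likelihood of the feedback about arm `k` over all click probabilities. -/
def armMaxLik (h : Hist K L n) (k : Fin K) : ℝ :=
  ∏ l, maxBernLik (clicks h k l) (count h k l)

section ArmLik

variable {κ : Fin L → ℝ} (h : Hist K L n) (k : Fin K)

theorem mul_mem_unit (hκ : ∀ l, 0 < κ l ∧ κ l ≤ 1) {q : ℝ} (h0 : 0 ≤ q) (h1 : q ≤ 1)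
    (l : Fin L) : 0 ≤ κ l * q ∧ κ l * q ≤ 1 :=
  ⟨mul_nonneg (hκ l).1.le h0, mul_le_one₀ (hκ l).2 h0 h1⟩

theorem mul_mem_openUnit (hκ : ∀ l, 0 < κ l ∧ κ l ≤ 1) {q : ℝ} (h0 : 0 < q) (h1 : q < 1)
    (l : Fin L) : 0 < κ l * q ∧ κ l * q < 1 :=
  ⟨mul_pos (hκ l).1 h0, (mul_le_of_le_one_left h0.le (hκ l).2).trans_lt h1⟩

theorem armLik_nonneg (hκ : ∀ l, 0 < κ l ∧ κ l ≤ 1) {q : ℝ} (h0 : 0 ≤ q) (h1 : q ≤ 1) :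
    0 ≤ armLik κ h k q :=
  Finset.prod_nonneg fun l _ =>
    bernLik_nonneg (mul_mem_unit hκ h0 h1 l).1 (mul_mem_unit hκ h0 h1 l).2

theorem armLik_pos (hκ : ∀ l, 0 < κ l ∧ κ l ≤ 1) {q : ℝ} (h0 : 0 < q) (h1 : q < 1) :
    0 < armLik κ h k q :=
  Finset.prod_pos fun l _ =>
    bernLik_pos (mul_mem_openUnit hκ h0 h1 l).1 (mul_mem_openUnit hκ h0 h1 l).2

theorem continuous_armLik (κ : Fin L → ℝ) : Continuous (armLik κ h k) := by
  unfold armLik bernLik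
  fun_prop

theorem armMaxLik_pos : 0 < armMaxLik h k :=
  Finset.prod_pos fun l _ => maxBernLik_pos (clicks_le_count h k l)

theorem divergence_eq (hκ : ∀ l, 0 < κ l ∧ κ l ≤ 1) {q : ℝ} (h0 : 0 ≤ q) (h1 : q ≤ 1) :
    divergence κ h k q = if armLik κ h k q = 0 then ⊤
      else ENNReal.ofReal (Real.log (armMaxLik h k) - Real.log (armLik κ h k q)) := by
  unfold divergence
  simp only [mul_klTop_eq (clicks_le_count h k _)]
  split_ifs with hz
  · obtain ⟨l, -, hl⟩ := Finset.prod_eq_zero_iff.1 hz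
    exact ENNReal.sum_eq_top.2 ⟨l, Finset.mem_univ l, by simp [hl]⟩
  · have hl : ∀ l, bernLik (clicks h k l) (count h k l) (κ l * q) ≠ 0 := fun l =>
      Finset.prod_ne_zero_iff.1 hz l (Finset.mem_univ l)
    simp only [hl, if_false]
    rw [← ENNReal.ofReal_sum_of_nonneg, armLik, armMaxLik, Real.log_prod fun l _ => hl l,
      Real.log_prod fun l _ => (maxBernLik_pos (clicks_le_count h k l)).ne',
      Finset.sum_sub_distrib]
    intro l _
    have hq := mul_mem_unit hκ h0 h1 l
    exact sub_nonneg.2 (Real.log_le_log ((bernLik_nonneg hq.1 hq.2).lt_of_ne (hl l).symm)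
      (bernLik_le_maxBernLik (clicks_le_count h k l) hq.1 hq.2))

theorem armLik_le_armMaxLik (hκ : ∀ l, 0 < κ l ∧ κ l ≤ 1) {q : ℝ} (h0 : 0 ≤ q) (h1 : q ≤ 1) :
    armLik κ h k q ≤ armMaxLik h k :=
  Finset.prod_le_prod (fun l _ =>
    bernLik_nonneg (mul_mem_unit hκ h0 h1 l).1 (mul_mem_unit hκ h0 h1 l).2) fun l _ =>
    bernLik_le_maxBernLik (clicks_le_count h k l) (mul_mem_unit hκ h0 h1 l).1
      (mul_mem_unit hκ h0 h1 l).2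

theorem divergence_le_divergence_iff (hκ : ∀ l, 0 < κ l ∧ κ l ≤ 1) {q r : ℝ} (hq0 : 0 ≤ q)
    (hq1 : q ≤ 1) (hr0 : 0 ≤ r) (hr1 : r ≤ 1) :
    divergence κ h k q ≤ divergence κ h k r ↔ armLik κ h k r ≤ armLik κ h k q := by
  have hqn := armLik_nonneg h k hκ hq0 hq1
  have hrn := armLik_nonneg h k hκ hr0 hr1
  rw [divergence_eq h k hκ hq0 hq1, divergence_eq h k hκ hr0 hr1]
  split_ifs with h1 h2 h2
  · simp [h1, h2]
  · simp only [top_le_iff, ENNReal.ofReal_ne_top, false_iff, not_le, h1]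
    exact hrn.lt_of_ne (Ne.symm h2)
  · simp [h2, hqn]
  · have hq := hqn.lt_of_ne (Ne.symm h1)
    have hr := hrn.lt_of_ne (Ne.symm h2)
    rw [ENNReal.ofReal_le_ofReal_iff, sub_le_sub_iff_left, Real.log_le_log_iff hr hq]
    exact sub_nonneg.2 (Real.log_le_log hr (armLik_le_armMaxLik h k hκ hr0 hr1))

/-- Likelihoods are quasi-concave. -/
theorem min_armLik_le (hκ : ∀ l, 0 < κ l ∧ κ l ≤ 1) {u x v : ℝ} (hu : 0 ≤ u) (hux : u ≤ x)
    (hxv : x ≤ v) (hv : v ≤ 1) :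
    min (armLik κ h k u) (armLik κ h k v) ≤ armLik κ h k x := by
  rcases (hux.trans hxv).eq_or_lt with rfl | huv
  · obtain rfl : u = x := le_antisymm hux hxv
    simp
  set r := (x - u) / (v - u) with hr
  have hd : 0 < v - u := sub_pos.2 huv
  have hr0 : 0 ≤ r := div_nonneg (sub_nonneg.2 hux) hd.le
  have hr1 : r ≤ 1 := div_le_one_of_le₀ (by linarith) hd.le
  have hx : x = (1 - r) * u + r * v := by
    have : r * (v - u) = x - u := div_mul_cancel₀ _ hd.ne'
    linarith
  have hmu := mul_mem_unit hκ hu (huv.le.trans hv)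
  have hmv := mul_mem_unit hκ (hu.trans huv.le) hv
  set m := min (armLik κ h k u) (armLik κ h k v) with hm
  have hm0 : 0 ≤ m := le_min (armLik_nonneg h k hκ hu (huv.le.trans hv))
    (armLik_nonneg h k hκ (hu.trans huv.le) hv)
  calc m = m ^ (1 - r) * m ^ r := by
        rw [← Real.rpow_add_of_nonneg hm0 (sub_nonneg.2 hr1) hr0, sub_add_cancel, Real.rpow_one]
    _ ≤ armLik κ h k u ^ (1 - r) * armLik κ h k v ^ r := by
        refine mul_le_mul (Real.rpow_le_rpow hm0 (min_le_left _ _) (sub_nonneg.2 hr1))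
          (Real.rpow_le_rpow hm0 (min_le_right _ _) hr0) (Real.rpow_nonneg hm0 _)
          (Real.rpow_nonneg (armLik_nonneg h k hκ hu (huv.le.trans hv)) _)
    _ = ∏ l, bernLik (clicks h k l) (count h k l) (κ l * u) ^ (1 - r) *
          bernLik (clicks h k l) (count h k l) (κ l * v) ^ r := by
        rw [Finset.prod_mul_distrib, Real.finsetProd_rpow, Real.finsetProd_rpow]
        · rfl
        · exact fun l _ => bernLik_nonneg (hmv l).1 (hmv l).2
        · exact fun l _ => bernLik_nonneg (hmu l).1 (hmu l).2
    _ ≤ armLik κ h k x := by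
        refine Finset.prod_le_prod (fun l _ => mul_nonneg
          (Real.rpow_nonneg (bernLik_nonneg (hmu l).1 (hmu l).2) _)
          (Real.rpow_nonneg (bernLik_nonneg (hmv l).1 (hmv l).2) _)) fun l _ => ?_
        refine (bernLik_rpow_mul_rpow_le (hmu l).1 (hmu l).2 (hmv l).1 (hmv l).2 hr0 hr1).trans_eq
          ?_
        congr 1
        rw [hx]
        ring

/-! ### The minimizer of the divergence and the index. -/

theorem exists_isMin_divergence (hκ : ∀ l, 0 < κ l ∧ κ l ≤ 1) :
    {q | q ∈ Set.Icc (0 : ℝ) 1 ∧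
      ∀ r ∈ Set.Icc (0 : ℝ) 1, divergence κ h k q ≤ divergence κ h k r}.Nonempty := by
  obtain ⟨q, hq, hmax⟩ := isCompact_Icc.exists_isMaxOn (Set.nonempty_Icc.2 zero_le_one)
    (continuous_armLik h k κ).continuousOn
  exact ⟨q, hq, fun r hr =>
    (divergence_le_divergence_iff h k hκ hq.1 hq.2 hr.1 hr.2).2 (hmax hr)⟩

theorem thetaMin_le_one (hκ : ∀ l, 0 < κ l ∧ κ l ≤ 1) : thetaMin κ h k ≤ 1 := by
  obtain ⟨q, hq⟩ := exists_isMin_divergence h k hκ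
  exact (csInf_le ⟨0, fun x hx => hx.1.1⟩ hq).trans hq.1.2

/-- A point left of `thetaMin` is also covered, because the index is never below `thetaMin`. Applied
at the true attractiveness, this makes the index optimistic. -/
theorem le_index (hκ : ∀ l, 0 < κ l ∧ κ l ≤ 1) {δ q : ℝ} (h1 : q ≤ 1)
    (hq : divergence κ h k q ≤ ENNReal.ofReal δ) : q ≤ index κ h k δ := by
  have hb : BddAbove (insert (thetaMin κ h k)
      {q | q ∈ Set.Icc (thetaMin κ h k) 1 ∧ divergence κ h k q ≤ ENNReal.ofReal δ}) := by
    refine ⟨1, ?_⟩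
    rintro x (rfl | hx)
    exacts [thetaMin_le_one h k hκ, hx.1.2]
  rcases le_total (thetaMin κ h k) q with hle | hle
  · exact le_csSup hb (Set.mem_insert_of_mem _ ⟨⟨hle, h1⟩, hq⟩)
  · exact hle.trans (le_csSup hb (Set.mem_insert _ _))

/-- By quasi-concavity: either `x` is left of all minimizers, where the likelihood increases weakly,
or it lies between a minimizer and a point satisfying the constraint, and then satisfies it too. For
`x` above the true attractiveness the first alternative is rare. -/
theorem of_lt_index (hκ : ∀ l, 0 < κ l ∧ κ l ≤ 1) {δ x : ℝ} (h0 : 0 ≤ x) (h1 : x ≤ 1)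
    (hx : x < index κ h k δ) :
    (∀ y, 0 ≤ y → y ≤ x → armLik κ h k y ≤ armLik κ h k x) ∨
      divergence κ h k x ≤ ENNReal.ofReal δ := by
  have hne := exists_isMin_divergence h k hκ
  rcases le_or_gt x (thetaMin κ h k) with hle | hlt
  · left
    obtain ⟨m, hm⟩ := hne
    have hxm : x ≤ m := hle.trans (csInf_le ⟨0, fun x hx => hx.1.1⟩ hm)
    intro y hy0 hyx
    have hym := (divergence_le_divergence_iff h k hκ hm.1.1 hm.1.2 hy0 (hyx.trans h1)).1
      (hm.2 y ⟨hy0, hyx.trans h1⟩)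
    have := min_armLik_le h k hκ hy0 hyx hxm hm.1.2
    rwa [min_eq_left hym] at this
  · right
    obtain ⟨m, hm, hmx⟩ := exists_lt_of_csInf_lt hne hlt
    obtain ⟨q, hq, hxq⟩ := exists_lt_of_lt_csSup (Set.insert_nonempty _ _) hx
    rcases hq with rfl | hq
    · exact absurd hxq hlt.not_gt
    refine le_trans ?_ hq.2
    have hq0 : 0 ≤ q := h0.trans hxq.le
    rw [divergence_le_divergence_iff h k hκ h0 h1 hq0 hq.1.2]
    have hqm := (divergence_le_divergence_iff h k hκ hm.1.1 hm.1.2 hq0 hq.1.2).1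
      (hm.2 q ⟨hq0, hq.1.2⟩)
    have := min_armLik_le h k hκ hm.1.1 hmx.le hxq.le hq.1.2
    rwa [min_eq_right hqm] at this

theorem count_mul_kl_le (hκ : ∀ l, 0 < κ l ∧ κ l ≤ 1) {δ x : ℝ} (h0 : 0 < x) (h1 : x < 1)
    (hδ : 0 ≤ δ) (hx : divergence κ h k x ≤ ENNReal.ofReal δ) (l : Fin L) :
    (count h k l : ℝ) * kl ((clicks h k l : ℝ) / count h k l) (κ l * x) ≤ δ := by
  have hq := mul_mem_openUnit hκ h0 h1 l
  have hne := (bernLik_pos (S := clicks h k l) (N := count h k l) hq.1 hq.2).ne'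
  have hle := (Finset.single_le_sum (f := fun l =>
    (count h k l : ℝ≥0∞) * klTop ((clicks h k l : ℝ) / (count h k l : ℝ)) (κ l * x))
    (fun _ _ => zero_le) (Finset.mem_univ l)).trans hx
  rw [mul_klTop_eq (clicks_le_count h k l), if_neg hne,
    ← mul_kl_eq (clicks_le_count h k l) hne] at hle
  exact (ENNReal.ofReal_le_ofReal_iff hδ).1 hle

theorem weight_likRatio (p q : Fin L → ℝ) :
    weight (fun l z => cond z (q l / p l) ((1 - q l) / (1 - p l))) k h =
      ∏ l, bernLik (clicks h k l) (count h k l) (q l) /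
        bernLik (clicks h k l) (count h k l) (p l) := by
  rw [weight_eq]
  refine Finset.prod_congr rfl fun l _ => ?_
  simp only [cond_true, cond_false, bernLik, div_pow]
  rw [div_mul_div_comm]

/-- The score is the log-likelihood ratio of `q` against `p`; in this form the exponential moment
bound applies to it. -/
theorem score_log_nonneg (hκ : ∀ l, 0 < κ l ∧ κ l ≤ 1) {p q : ℝ} (hp0 : 0 < p) (hp1 : p < 1)
    (hq0 : 0 < q) (hq1 : q < 1) (hpq : armLik κ h k p ≤ armLik κ h k q) :
    0 ≤ score (fun l => Real.log (κ l * q / (κ l * p)))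
      (fun l => Real.log ((1 - κ l * q) / (1 - κ l * p))) k h := by
  have hp := mul_mem_openUnit hκ hp0 hp1
  have hq := mul_mem_openUnit hκ hq0 hq1
  rw [← Real.one_le_exp_iff, ← one_mul (score _ _ k h), exp_score]
  have : (fun l z => Real.exp (1 * cond z (Real.log (κ l * q / (κ l * p)))
      (Real.log ((1 - κ l * q) / (1 - κ l * p))))) =
      fun l z => cond z (κ l * q / (κ l * p)) ((1 - κ l * q) / (1 - κ l * p)) := by
    funext l z
    cases z
    · simp only [one_mul, cond_false]
      exact Real.exp_log (div_pos (sub_pos.2 (hq l).2) (sub_pos.2 (hp l).2))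
    · simp only [one_mul, cond_true]
      exact Real.exp_log (div_pos (hq l).1 (hp l).1)
  rw [this, weight_likRatio h k (fun l => κ l * p) fun l => κ l * q, Finset.prod_div_distrib]
  exact (one_le_div (armLik_pos h k hκ hp0 hp1)).2 hpq

end ArmLik

/-! ### Mixtures of likelihood ratios -/

theorem one_le_maxBernLik_div {S N : ℕ} (h : S ≤ N) {p : ℝ} (h0 : 0 < p) (h1 : p < 1) :
    1 ≤ maxBernLik S N / bernLik S N p :=
  (one_le_div (bernLik_pos h0 h1)).2 (bernLik_le_maxBernLik h h0.le h1.le)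

/-- A point between `p` and the empirical frequency, at a proportion at least `ρ` of the way,
has a large likelihood. -/
theorem rpow_maxBernLik_div_le {S N : ℕ} (h : S ≤ N) {p r ρ : ℝ} (h0 : 0 < p) (h1 : p < 1)
    (hr0 : 0 ≤ r) (hr1 : r ≤ 1) (hρ : ρ ≤ r) :
    (maxBernLik S N / bernLik S N p) ^ ρ ≤
      bernLik S N ((1 - r) * p + r * ((S : ℝ) / N)) / bernLik S N p := by
  have hp := bernLik_pos (S := S) (N := N) h0 h1
  have hm := maxBernLik_pos h
  have hf := freq_mem h
  refine (Real.rpow_le_rpow_of_exponent_le (one_le_maxBernLik_div h h0 h1) hρ).trans ?_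
  rw [le_div_iff₀ hp, Real.div_rpow hm.le hp.le, div_mul_eq_mul_div]
  refine le_trans (le_of_eq ?_)
    (bernLik_rpow_mul_rpow_le (S := S) (N := N) h0.le h1.le hf.1 hf.2 hr0 hr1)
  rw [Real.rpow_sub hp, Real.rpow_one, maxBernLik]
  ring

/-- With f the frequency, (f/p)^S ≤ exp(n|f − p|/p), and likewise for the failures. -/
theorem maxBernLik_div_le_of_near {S N n : ℕ} (h : S ≤ N) (hN : N ≤ n) {p : ℝ} (h0 : 0 < p)
    (h1 : p < 1) (hnear : |(S : ℝ) / N - p| * n ≤ 1) :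
    maxBernLik S N / bernLik S N p ≤ Real.exp (1 / p + 1 / (1 - p)) := by
  have hf := freq_mem h
  have h1' := sub_pos.2 h1
  set d := |(S : ℝ) / N - p| with hd
  have hd0 : 0 ≤ d := abs_nonneg _
  have key : ∀ (m : ℕ) (x y : ℝ), m ≤ n → 0 ≤ x → 0 < y → |x - y| ≤ d →
      (x / y) ^ m ≤ Real.exp (1 / y) := by
    intro m x y hm hx hy hxy
    have hxy' : x / y ≤ Real.exp (d / y) := by
      have h2 : x / y ≤ d / y + 1 := by
        rw [div_add_one hy.ne']
        exact div_le_div_of_nonneg_right (by linarith [le_abs_self (x - y)]) hy.le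
      exact h2.trans (Real.add_one_le_exp _)
    refine (pow_le_pow_left₀ (by positivity) hxy' m).trans ?_
    rw [← Real.exp_nat_mul, Real.exp_le_exp, ← mul_div_assoc]
    refine div_le_div_of_nonneg_right ?_ hy.le
    calc (m : ℝ) * d ≤ n * d := by gcongr
      _ ≤ 1 := by linarith
  have e : maxBernLik S N / bernLik S N p =
      ((S : ℝ) / N / p) ^ S * ((1 - (S : ℝ) / N) / (1 - p)) ^ (N - S) := by
    rw [maxBernLik, bernLik, bernLik, div_pow _ p, div_pow _ (1 - p), div_mul_div_comm]
  rw [e, Real.exp_add]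
  refine mul_le_mul (key _ _ _ (h.trans hN) hf.1 h0 le_rfl)
    (key _ _ _ ((Nat.sub_le _ _).trans hN) (sub_nonneg.2 hf.2) h1' (le_of_eq ?_))
    (pow_nonneg (div_nonneg (sub_nonneg.2 hf.2) h1'.le) _) (Real.exp_pos _).le
  rw [hd, ← abs_neg]
  congr 1
  ring

/-- Logarithmically many parameters suffice to approximate the maximal likelihood of at most `n`
trials, up to a constant and a power `ρ < 1`. -/
theorem exists_grid {p ρ : ℝ} (h0 : 0 < p) (h1 : p < 1) (hρ0 : 0 < ρ) (hρ1 : ρ < 1) :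
    ∃ A > 0, ∀ n : ℕ, 1 ≤ n → ∃ G : Finset ℝ, (∀ q ∈ G, 0 < q ∧ q < 1) ∧
      (G.card : ℝ) ≤ A * (1 + Real.log n) ∧
      ∀ S N : ℕ, S ≤ N → N ≤ n → (maxBernLik S N / bernLik S N p) ^ ρ ≤
        Real.exp (1 / p + 1 / (1 - p)) * ∑ q ∈ G, bernLik S N q / bernLik S N p := by
  have h1' := sub_pos.2 h1
  have hlρ : 0 < Real.log (1 / ρ) := Real.log_pos ((one_lt_div hρ0).2 hρ1)
  refine ⟨3 + 2 / Real.log (1 / ρ), by positivity, fun n hn => ?_⟩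
  have hn' : (1 : ℝ) ≤ n := by exact_mod_cast hn
  have hn0 : (0 : ℝ) < n := by linarith
  have hln : 0 ≤ Real.log n := Real.log_nonneg hn'
  -- `J` is the number of scales needed for ρ^J ≤ 1/n; the grid will have at most 2J + 1 points,
  -- whence the constant above.
  set J := ⌈Real.log n / Real.log (1 / ρ)⌉₊ with hJ
  have hJn : ρ ^ J * n ≤ 1 := by
    have h2 : Real.log n ≤ J * Real.log (1 / ρ) :=
      (div_le_iff₀ hlρ).1 (Nat.le_ceil _)
    rw [one_div, Real.log_inv] at h2
    rw [← Real.log_nonpos_iff (by positivity), Real.log_mul (by positivity) hn0.ne', Real.log_pow]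
    linarith
  classical
  -- Points at relative distances ρ, …, ρ^J from p towards 1 and towards 0. A frequency at relative
  -- distance in (ρ^(j+1), ρ^j] then has a grid point at a proportion at least ρ of the way from p
  -- to it.
  let up : ℕ → ℝ := fun j => p + (1 - p) * ρ ^ (j + 1)
  let dn : ℕ → ℝ := fun j => p - p * ρ ^ (j + 1)
  have hpow : ∀ j : ℕ, 0 < ρ ^ (j + 1) ∧ ρ ^ (j + 1) < 1 := fun j =>
    ⟨pow_pos hρ0 _, pow_lt_one₀ hρ0.le hρ1 (by omega)⟩
  set G : Finset ℝ := insert p ((Finset.range J).image up ∪ (Finset.range J).image dn) with hG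
  have hG01 : ∀ q ∈ G, 0 < q ∧ q < 1 := by
    intro q hq
    simp only [hG, Finset.mem_insert, Finset.mem_union, Finset.mem_image] at hq
    rcases hq with rfl | ⟨j, -, rfl⟩ | ⟨j, -, rfl⟩
    · exact ⟨h0, h1⟩
    · have := hpow j
      constructor
      · have := mul_pos h1' this.1
        simp only [up]
        linarith
      · have := mul_lt_mul_of_pos_left this.2 h1'
        simp only [up]
        linarith
    · have := hpow j
      constructor
      · have := mul_lt_mul_of_pos_left this.2 h0
        simp only [dn]
        linarith
      · have := mul_pos h0 this.1
        simp only [dn]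
        linarith
  refine ⟨G, hG01, ?_, fun S N hSN hNn => ?_⟩
  · have hc : G.card ≤ 2 * J + 1 := by
      refine (Finset.card_insert_le _ _).trans ?_
      have h2 := Finset.card_union_le ((Finset.range J).image up) ((Finset.range J).image dn)
      have h3 := Finset.card_image_le (s := Finset.range J) (f := up)
      have h4 := Finset.card_image_le (s := Finset.range J) (f := dn)
      rw [Finset.card_range] at h3 h4
      omega
    have hJle : (J : ℝ) ≤ Real.log n / Real.log (1 / ρ) + 1 :=
      (Nat.ceil_lt_add_one (div_nonneg hln hlρ.le)).le
    calc (G.card : ℝ) ≤ 2 * J + 1 := by exact_mod_cast hc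
      _ ≤ 2 * (Real.log n / Real.log (1 / ρ) + 1) + 1 := by linarith
      _ = 3 + 2 / Real.log (1 / ρ) * Real.log n := by ring
      _ ≤ (3 + 2 / Real.log (1 / ρ)) * (1 + Real.log n) := by
        have : 0 ≤ 2 / Real.log (1 / ρ) := by positivity
        nlinarith
  · have hp := bernLik_pos (S := S) (N := N) h0 h1
    have hnn : ∀ q ∈ G, 0 ≤ bernLik S N q / bernLik S N p := fun q hq =>
      div_nonneg (bernLik_nonneg (hG01 q hq).1.le (hG01 q hq).2.le) hp.le
    have hC : 1 ≤ Real.exp (1 / p + 1 / (1 - p)) := Real.one_le_exp (by positivity)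
    have hf := freq_mem hSN
    have hfar : ∀ q ∈ G, (∃ r, ρ ≤ r ∧ r ≤ 1 ∧ q - p = r * ((S : ℝ) / N - p)) →
        (maxBernLik S N / bernLik S N p) ^ ρ ≤
        Real.exp (1 / p + 1 / (1 - p)) * ∑ q ∈ G, bernLik S N q / bernLik S N p := by
      rintro q hq ⟨r, hρr, hr1, hqr⟩
      have hq' : q = (1 - r) * p + r * ((S : ℝ) / N) := by linarith
      have h2 := rpow_maxBernLik_div_le hSN h0 h1 (hρ0.le.trans hρr) hr1 hρr
      rw [← hq'] at h2
      refine (h2.trans (Finset.single_le_sum hnn hq)).trans ?_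
      exact le_mul_of_one_le_left (Finset.sum_nonneg hnn) hC
    have hstep : ∀ x : ℝ, ρ ^ J < x → x ≤ 1 →
        ∃ j ∈ Finset.range J, ρ ^ (j + 1) < x ∧ x ≤ ρ ^ j := by
      intro x hx hx1
      obtain ⟨j, hj1, hj2⟩ := exists_nat_pow_near_of_lt_one
        ((pow_pos hρ0 J).trans hx) hx1 hρ0 hρ1
      refine ⟨j, Finset.mem_range.2 ?_, hj1, hj2⟩
      by_contra hjJ
      exact absurd (hx.trans_le hj2)
        (not_lt.2 (pow_le_pow_of_le_one hρ0.le hρ1.le (not_lt.1 hjJ)))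
    have hratio : ∀ (j : ℕ) (x : ℝ), ρ ^ (j + 1) < x → x ≤ ρ ^ j →
        ρ ≤ ρ ^ (j + 1) / x ∧ ρ ^ (j + 1) / x ≤ 1 := by
      intro j x h2 h3
      have hx0 := (pow_pos hρ0 (j + 1)).trans h2
      refine ⟨?_, (div_le_one hx0).2 h2.le⟩
      rw [le_div_iff₀ hx0, pow_succ']
      exact mul_le_mul_of_nonneg_left h3 hρ0.le
    by_cases hup : ρ ^ J < ((S : ℝ) / N - p) / (1 - p)
    · obtain ⟨j, hj, hj1, hj2⟩ := hstep _ hup ((div_le_one h1').2 (by linarith))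
      refine hfar (up j) (Finset.mem_insert_of_mem (Finset.mem_union.2
        (Or.inl (Finset.mem_image_of_mem up hj)))) ⟨_, (hratio j _ hj1 hj2).1,
        (hratio j _ hj1 hj2).2, ?_⟩
      have : (S : ℝ) / N - p ≠ 0 := fun h => by
        rw [h, zero_div] at hup
        exact absurd hup (pow_pos hρ0 J).not_gt
      simp only [up]
      field_simp
      ring
    by_cases hdn : ρ ^ J < (p - (S : ℝ) / N) / p
    · obtain ⟨j, hj, hj1, hj2⟩ := hstep _ hdn ((div_le_one h0).2 (by linarith))
      refine hfar (dn j) (Finset.mem_insert_of_mem (Finset.mem_union.2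
        (Or.inr (Finset.mem_image_of_mem dn hj)))) ⟨_, (hratio j _ hj1 hj2).1,
        (hratio j _ hj1 hj2).2, ?_⟩
      have : p - (S : ℝ) / N ≠ 0 := fun h => by
        rw [h, zero_div] at hdn
        exact absurd hdn (pow_pos hρ0 J).not_gt
      simp only [dn]
      rw [show (S : ℝ) / N - p = -(p - (S : ℝ) / N) by ring]
      generalize p - (S : ℝ) / N = y at this
      field_simp
      ring
    -- The remaining frequencies are within ρ^J ≤ 1/n of p: the grid point p, of ratio 1, and the
    -- exponential constant suffice.
    · rw [not_lt, div_le_iff₀ h1'] at hup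
      rw [not_lt, div_le_iff₀ h0] at hdn
      have hρJ : 0 < ρ ^ J := pow_pos hρ0 J
      have hnear : |(S : ℝ) / N - p| * n ≤ 1 := by
        refine le_trans (mul_le_mul_of_nonneg_right (abs_le.2 ⟨?_, ?_⟩) hn0.le) hJn
        · nlinarith
        · nlinarith
      refine (Real.rpow_le_rpow_of_exponent_le (one_le_maxBernLik_div hSN h0 h1) hρ1.le).trans ?_
      rw [Real.rpow_one]
      refine (maxBernLik_div_le_of_near hSN hNn h0 h1 hnear).trans ?_
      refine le_mul_of_one_le_right (by positivity) ?_
      refine le_trans (le_of_eq ?_) (Finset.single_le_sum hnn (Finset.mem_insert_self p _))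
      rw [div_self hp.ne']

/-! ### The divergence at the true parameter -/

theorem Model.κ_mem (M : Model K L) : ∀ l, 0 < M.κ l ∧ M.κ l ≤ 1 := fun l =>
  ⟨M.κ_pos l, M.κ_le_one l⟩

/-- The ratio is a weight with one-step mean exactly 1. The vector `q` is arbitrary, not only of the
form κ_l q, which allows an independent grid at each position. -/
theorem Model.expectHist_likRatio_le_one (M : Model K L) (π : Policy K L) (k : Fin K)
    (q : Fin L → ℝ) (hq : ∀ l, 0 < q l ∧ q l < 1) (n : ℕ) :
    M.expectHist π n (fun h => ∏ l, bernLik (clicks h k l) (count h k l) (q l) /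
      bernLik (clicks h k l) (count h k l) (M.κ l * M.θ k)) ≤ 1 := by
  simp only [← weight_likRatio _ k (fun l => M.κ l * M.θ k) q]
  refine M.expectHist_weight_le_one π (fun l z => ?_) k (fun l => ?_) n
  · have h0 := M.prob_pos k l
    have h1 := sub_pos.2 (M.prob_lt_one k l)
    have h2 := (hq l).1
    have h3 := sub_pos.2 (hq l).2
    cases z
    · exact (div_pos h3 h1).le
    · exact (div_pos h2 h0).le
  · have h0 := M.prob_pos k l
    have h1 := sub_pos.2 (M.prob_lt_one k l)
    simp only [cond_true, cond_false]
    rw [mul_div_cancel₀ _ h0.ne', mul_div_cancel₀ _ h1.ne']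
    linarith

open Classical in
-- Markov's inequality for a sum of likelihood ratios over the product of the grids: failure of the
-- bound forces the maximal ratio, raised to the power ρ, above e^{ρδ}.
theorem Model.exists_prob_divergence_le (M : Model K L) (k : Fin K) {ρ : ℝ} (hρ0 : 0 < ρ)
    (hρ1 : ρ < 1) :
    ∃ D ≥ 0, ∀ (π : Policy K L) (n : ℕ) (δ : ℝ),
      M.expectHist π n (fun h =>
        if divergence M.κ h k (M.θ k) ≤ ENNReal.ofReal δ then 0 else 1) ≤
      Real.exp (-(ρ * δ)) * (D * (1 + Real.log ((n : ℝ) + 1)) ^ L) := by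
  choose A hA hgrid using fun l : Fin L =>
    exists_grid (M.prob_pos k l) (M.prob_lt_one k l) hρ0 hρ1
  set C : Fin L → ℝ := fun l =>
    Real.exp (1 / (M.κ l * M.θ k) + 1 / (1 - M.κ l * M.θ k)) with hC
  refine ⟨∏ l, C l * A l, Finset.prod_nonneg fun l _ => mul_nonneg (Real.exp_pos _).le (hA l).le,
    fun π n δ => ?_⟩
  -- The grid for n + 1 trials also covers n = 0.
  choose G hG01 hGcard hGle using fun l => hgrid l (n + 1) (by omega)
  push_cast at hGcard
  have hmark : ∀ h : Hist K L n,
      (if divergence M.κ h k (M.θ k) ≤ ENNReal.ofReal δ then (0 : ℝ) else 1) ≤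
      (Real.exp (-(ρ * δ)) * ∏ l, C l) * ∑ g ∈ Fintype.piFinset G,
        ∏ l, bernLik (clicks h k l) (count h k l) (g l) /
          bernLik (clicks h k l) (count h k l) (M.κ l * M.θ k) := by
    intro h
    have hp : ∀ l, 0 < bernLik (clicks h k l) (count h k l) (M.κ l * M.θ k) := fun l =>
      bernLik_pos (M.prob_pos k l) (M.prob_lt_one k l)
    have hR : ∀ l, 0 ≤ maxBernLik (clicks h k l) (count h k l) /
        bernLik (clicks h k l) (count h k l) (M.κ l * M.θ k) := fun l =>
      div_nonneg (maxBernLik_pos (clicks_le_count h k l)).le (hp l).le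
    have hmain : (∏ l, maxBernLik (clicks h k l) (count h k l) /
        bernLik (clicks h k l) (count h k l) (M.κ l * M.θ k)) ^ ρ ≤
        (∏ l, C l) * ∑ g ∈ Fintype.piFinset G,
        ∏ l, bernLik (clicks h k l) (count h k l) (g l) /
          bernLik (clicks h k l) (count h k l) (M.κ l * M.θ k) := by
      rw [← Finset.prod_univ_sum G fun l q => bernLik (clicks h k l) (count h k l) q /
          bernLik (clicks h k l) (count h k l) (M.κ l * M.θ k), ← Finset.prod_mul_distrib,
        ← Real.finsetProd_rpow _ _ fun l _ => hR l]
      refine Finset.prod_le_prod (fun l _ => Real.rpow_nonneg (hR l) _) fun l _ => ?_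
      exact hGle l _ _ (clicks_le_count h k l) ((count_le h k l).trans (by omega))
    rw [mul_assoc]
    split_ifs with hdiv
    · exact mul_nonneg (Real.exp_pos _).le
        ((Real.rpow_nonneg (Finset.prod_nonneg fun l _ => hR l) _).trans hmain)
    · refine le_trans ?_ (mul_le_mul_of_nonneg_left hmain (Real.exp_pos _).le)
      have hlik := armLik_pos h k M.κ_mem (M.θ_pos k) (M.θ_lt_one k)
      rw [divergence_eq h k M.κ_mem (M.θ_pos k).le (M.θ_lt_one k).le, if_neg hlik.ne',
        not_le] at hdiv
      have hlt : δ ≤ Real.log (armMaxLik h k) - Real.log (armLik M.κ h k (M.θ k)) := by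
        by_contra hcon
        exact absurd hdiv (not_lt.2 (ENNReal.ofReal_le_ofReal (not_le.1 hcon).le))
      rw [← Real.log_div (armMaxLik_pos h k).ne' hlik.ne'] at hlt
      have hpos := div_pos (armMaxLik_pos h k) hlik
      rw [Finset.prod_div_distrib]
      change 1 ≤ Real.exp (-(ρ * δ)) * (armMaxLik h k / armLik M.κ h k (M.θ k)) ^ ρ
      rw [Real.rpow_def_of_pos hpos, ← Real.exp_add]
      refine Real.one_le_exp ?_
      nlinarith
  refine (expect_mono hmark).trans ?_
  rw [expect_const_mul, expect_sum]
  have hnn : 0 ≤ ∏ l, C l := Finset.prod_nonneg fun l _ => (Real.exp_pos _).le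
  have hcard : ((Fintype.piFinset G).card : ℝ) ≤
      (∏ l, A l) * (1 + Real.log ((n : ℝ) + 1)) ^ L := by
    rw [Fintype.card_piFinset, Nat.cast_prod]
    refine (Finset.prod_le_prod (fun _ _ => Nat.cast_nonneg _) fun l _ => hGcard l).trans_eq ?_
    rw [Finset.prod_mul_distrib, Finset.prod_const, Finset.card_univ, Fintype.card_fin]
  have hsum : ∑ g ∈ Fintype.piFinset G, expect (M.law π n) (fun h =>
      ∏ l, bernLik (clicks h k l) (count h k l) (g l) /
        bernLik (clicks h k l) (count h k l) (M.κ l * M.θ k)) ≤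
      (∏ l, A l) * (1 + Real.log ((n : ℝ) + 1)) ^ L := by
    refine le_trans (Finset.sum_le_card_nsmul _ _ 1 fun g hg => ?_) (by simpa using hcard)
    exact M.expectHist_likRatio_le_one π k g
      (fun l => hG01 l _ (Fintype.mem_piFinset.1 hg l)) n
  refine (mul_le_mul_of_nonneg_left hsum (mul_nonneg (Real.exp_pos _).le hnn)).trans_eq ?_
  rw [Finset.prod_mul_distrib]
  ring

theorem exists_one_add_log_pow_le (L : ℕ) {s : ℝ} (hs : 0 < s) :
    ∃ B ≥ 0, ∀ x : ℝ, 1 ≤ x → (1 + Real.log x) ^ L ≤ B * x ^ s := by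
  set u := s / (L + 1) with hu
  have hu0 : 0 < u := by positivity
  refine ⟨(1 + 1 / u) ^ L, by positivity, fun x hx => ?_⟩
  have hx0 : 0 ≤ x := by linarith
  have h1 : 1 + Real.log x ≤ (1 + 1 / u) * x ^ u := by
    have h2 := Real.log_le_rpow_div hx0 hu0
    have h3 := Real.one_le_rpow hx hu0.le
    calc _ ≤ x ^ u + x ^ u / u := add_le_add h3 h2
      _ = _ := by ring
  refine (pow_le_pow_left₀ (by linarith [Real.log_nonneg hx]) h1 L).trans ?_
  rw [mul_pow, ← Real.rpow_mul_natCast hx0]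
  refine mul_le_mul_of_nonneg_left (Real.rpow_le_rpow_of_exponent_le hx ?_) (by positivity)
  rw [hu, div_mul_eq_mul_div, div_le_iff₀ (by positivity)]
  nlinarith

open Classical in
/-- The expected number of rounds at which the divergence of an arm at its true attractiveness
exceeds the exploration threshold is bounded. -/
theorem Model.exists_sum_prob_divergence_le (M : Model K L) (k : Fin K) {ε : ℝ} (hε : 0 < ε) :
    ∃ D ≥ 0, ∀ (π : Policy K L) (T : ℕ),
      ∑ n ∈ Finset.range T, M.expectHist π n (fun h =>
        if divergence M.κ h k (M.θ k) ≤ ENNReal.ofReal ((1 + ε) * Real.log ((n : ℝ) + 1))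
          then 0 else 1) ≤ D := by
  -- With this ρ, ρ(1+ε) = 1 + ε/2; the power of the logarithm absorbs ε/4 of it, leaving the
  -- summable exponent −(1 + ε/4).
  have hρ : (1 + ε / 2) / (1 + ε) < 1 := (div_lt_one (by positivity)).2 (by linarith)
  obtain ⟨D, hD, hbound⟩ := M.exists_prob_divergence_le k (by positivity) hρ
  obtain ⟨B, hB, hlog⟩ := exists_one_add_log_pow_le L (s := ε / 4) (by positivity)
  have hsm : Summable fun n : ℕ => ((n : ℝ) + 1) ^ (-(1 + ε / 4)) := by
    have := (summable_nat_add_iff 1).2 (Real.summable_nat_rpow.2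
      (show -(1 + ε / 4) < -1 by linarith))
    simpa using this
  have hnn : ∀ n : ℕ, 0 ≤ ((n : ℝ) + 1) ^ (-(1 + ε / 4)) := fun n =>
    Real.rpow_nonneg (by positivity) _
  refine ⟨(D * B) * ∑' n : ℕ, ((n : ℝ) + 1) ^ (-(1 + ε / 4)),
    mul_nonneg (mul_nonneg hD hB) (tsum_nonneg hnn), fun π T => ?_⟩
  refine le_trans ?_ (mul_le_mul_of_nonneg_left (hsm.sum_le_tsum (Finset.range T)
    fun n _ => hnn n) (mul_nonneg hD hB))
  rw [Finset.mul_sum]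
  refine Finset.sum_le_sum fun n _ => (hbound π n _).trans ?_
  have hn1 : (1 : ℝ) ≤ (n : ℝ) + 1 := by linarith [Nat.cast_nonneg (α := ℝ) n]
  have hn0 : (0 : ℝ) < (n : ℝ) + 1 := by linarith
  have e : Real.exp (-((1 + ε / 2) / (1 + ε) * ((1 + ε) * Real.log ((n : ℝ) + 1)))) =
      ((n : ℝ) + 1) ^ (-(1 + ε / 2)) := by
    rw [Real.rpow_def_of_pos hn0]
    congr 1
    field_simp
  rw [e]
  calc _ ≤ ((n : ℝ) + 1) ^ (-(1 + ε / 2)) * (D * (B * ((n : ℝ) + 1) ^ (ε / 4))) := by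
        gcongr
        exact hlog _ hn1
    _ = D * B * (((n : ℝ) + 1) ^ (-(1 + ε / 2)) * ((n : ℝ) + 1) ^ (ε / 4)) := by ring
    _ = _ := by
        rw [← Real.rpow_add hn0]
        congr 2
        ring

/-! ### Rare events at the rounds in which an arm is shown -/

theorem Model.sum_expectHist_mono (M : Model K L) (π : Policy K L) (T : ℕ)
    {f g : ∀ n, Hist K L n → ℝ} (h : ∀ n < T, ∀ x, f n x ≤ g n x) :
    ∑ n ∈ Finset.range T, M.expectHist π n (f n) ≤ ∑ n ∈ Finset.range T, M.expectHist π n (g n) :=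
  Finset.sum_le_sum fun n hn => expect_mono (h n (Finset.mem_range.1 hn))

theorem Model.sum_expectHist_add (M : Model K L) (π : Policy K L) (T : ℕ)
    (f g : ∀ n, Hist K L n → ℝ) :
    ∑ n ∈ Finset.range T, M.expectHist π n (fun x => f n x + g n x) =
      ∑ n ∈ Finset.range T, M.expectHist π n (f n) +
        ∑ n ∈ Finset.range T, M.expectHist π n (g n) := by
  simp only [Model.expectHist, expect_add, Finset.sum_add_distrib]

theorem Model.sum_expectHist_const_mul (M : Model K L) (π : Policy K L) (T : ℕ) (c : ℝ)
    (f : ∀ n, Hist K L n → ℝ) :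
    ∑ n ∈ Finset.range T, M.expectHist π n (fun x => c * f n x) =
      c * ∑ n ∈ Finset.range T, M.expectHist π n (f n) := by
  simp only [Model.expectHist, expect_const_mul, Finset.mul_sum]

theorem Model.sum_expectHist_sum {ι : Type*} (s : Finset ι) (M : Model K L) (π : Policy K L)
    (T : ℕ) (f : ι → ∀ n, Hist K L n → ℝ) :
    ∑ n ∈ Finset.range T, M.expectHist π n (fun x => ∑ i ∈ s, f i n x) =
      ∑ i ∈ s, ∑ n ∈ Finset.range T, M.expectHist π n (f i n) := by
  simp only [Model.expectHist, expect_sum]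
  exact Finset.sum_comm

theorem ite_one_zero_nonneg (P : Prop) [Decidable P] : (0 : ℝ) ≤ if P then 1 else 0 := by
  split_ifs <;> norm_num

open Classical in
-- With S the clicks and D = ∑ κ_l N_l, a deviation means S − θ_k D ≥ ηD or θ_k D − S ≥ ηD. Both
-- differences are nonnegative scores of drift −ηκ_l at every position.
theorem Model.exists_sum_playProb_estimate_le (M : Model K L) (k : Fin K) (l : Fin L) {η : ℝ}
    (hη : 0 < η) :
    ∃ C ≥ 0, ∀ (π : Policy K L) (T : ℕ),
      ∑ n ∈ Finset.range T, M.expectHist π n (fun h =>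
        playProb π h l k * (if η ≤ |estimate M.κ h k - M.θ k| then 1 else 0)) ≤ C := by
  have hneg : ∀ l, -(η * M.κ l) < 0 := fun l => neg_neg_of_pos (mul_pos hη (M.κ_pos l))
  obtain ⟨t, ht, C, hC, hup⟩ := M.exists_sum_playProb_mul_exp_score_le k
    (fun l => 1 - M.κ l * M.θ k - η * M.κ l) (fun l => -(M.κ l * M.θ k) - η * M.κ l)
    (fun l => Or.inr (by convert hneg l using 1; ring)) l (by convert hneg l using 1; ring)
  obtain ⟨t', ht', C', hC', hdn⟩ := M.exists_sum_playProb_mul_exp_score_le k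
    (fun l => -(1 - M.κ l * M.θ k) - η * M.κ l) (fun l => M.κ l * M.θ k - η * M.κ l)
    (fun l => Or.inr (by convert hneg l using 1; ring)) l (by convert hneg l using 1; ring)
  refine ⟨C + C', add_nonneg hC hC', fun π T => ?_⟩
  refine le_trans ?_ (add_le_add (hup π T) (hdn π T))
  rw [← M.sum_expectHist_add]
  refine M.sum_expectHist_mono π T fun n _ h => ?_
  rw [← mul_add]
  refine mul_le_mul_of_nonneg_left ?_ (playProb_nonneg π h l k)
  split_ifs with hdev
  swap
  · positivity
  set S : ℝ := ∑ l, (clicks h k l : ℝ) with hS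
  set D : ℝ := ∑ l, M.κ l * (count h k l : ℝ) with hD
  have hS0 : 0 ≤ S := Finset.sum_nonneg fun l _ => Nat.cast_nonneg _
  have hterm : ∀ l, 0 ≤ M.κ l * (count h k l : ℝ) := fun l =>
    mul_nonneg (M.κ_pos l).le (Nat.cast_nonneg _)
  have hD0 : 0 ≤ D := Finset.sum_nonneg fun l _ => hterm l
  have hSD : D = 0 → S = 0 := fun h0 => Finset.sum_eq_zero fun l _ => by
    have h1 := (Finset.sum_eq_zero_iff_of_nonneg fun l _ => hterm l).1 h0 l (Finset.mem_univ l)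
    have h2 : count h k l = 0 := by simpa [(M.κ_pos l).ne'] using h1
    have h3 := clicks_le_count h k l
    rw [h2, Nat.le_zero] at h3
    simp [h3]
  -- Also valid for an arm never shown, whose estimate defaults to 0; both scores are then 0.
  have hest : estimate M.κ h k * D = S := by
    rcases eq_or_ne D 0 with h0 | h0
    · rw [h0, hSD h0, mul_zero]
    · exact div_mul_cancel₀ _ h0
  have e1 : score (fun l => 1 - M.κ l * M.θ k - η * M.κ l)
      (fun l => -(M.κ l * M.θ k) - η * M.κ l) k h = S - M.θ k * D - η * D := by
    rw [score, hS, hD, Finset.mul_sum, Finset.mul_sum, ← Finset.sum_sub_distrib,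
      ← Finset.sum_sub_distrib]
    exact Finset.sum_congr rfl fun l _ => by ring
  have e2 : score (fun l => -(1 - M.κ l * M.θ k) - η * M.κ l)
      (fun l => M.κ l * M.θ k - η * M.κ l) k h = M.θ k * D - S - η * D := by
    rw [score, hS, hD, Finset.mul_sum, Finset.mul_sum, ← Finset.sum_sub_distrib,
      ← Finset.sum_sub_distrib]
    exact Finset.sum_congr rfl fun l _ => by ring
  rw [e1, e2]
  rcases le_abs'.1 hdev with hlo | hhi
  · have h1 : 0 ≤ M.θ k * D - S - η * D := by nlinarith
    have h2 := Real.one_le_exp (mul_nonneg ht'.le h1)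
    linarith [Real.exp_pos (t * (S - M.θ k * D - η * D))]
  · have h1 : 0 ≤ S - M.θ k * D - η * D := by nlinarith
    have h2 := Real.one_le_exp (mul_nonneg ht.le h1)
    linarith [Real.exp_pos (t' * (M.θ k * D - S - η * D))]

open Classical in
-- Penalizing the centred score by c/2 instead of c per showing keeps a negative drift and leaves a
-- surplus (c/2)N ≥ (c/2)x on the event, which yields the exponential factor.
theorem Model.exists_sum_playProb_freq_le (M : Model K L) (k : Fin K) (l : Fin L) {c : ℝ}
    (hc : 0 < c) :
    ∃ t > 0, ∃ C ≥ 0, ∀ (π : Policy K L) (T : ℕ) (x : ℝ),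
      ∑ n ∈ Finset.range T, M.expectHist π n (fun h => playProb π h l k *
        (if x ≤ count h k l ∧ c ≤ |(clicks h k l : ℝ) / count h k l - M.κ l * M.θ k|
          then 1 else 0)) ≤ C * Real.exp (-(t * x)) := by
  have hex : ∀ s : ℝ, ∃ t > 0, ∃ C ≥ 0, ∀ (π : Policy K L) (T : ℕ),
      ∑ n ∈ Finset.range T, M.expectHist π n (fun h => playProb π h l k *
        Real.exp (t * (s * (clicks h k l - M.κ l * M.θ k * count h k l) -
          c / 2 * count h k l))) ≤ C := by
    intro s
    have hneg : -(c / 2) < 0 := by linarith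
    obtain ⟨t, ht, C, hC, h⟩ := M.exists_sum_playProb_mul_exp_score_le k
      (fun l' => if l' = l then s * (1 - M.κ l * M.θ k) - c / 2 else 0)
      (fun l' => if l' = l then -(s * (M.κ l * M.θ k)) - c / 2 else 0)
      (fun l' => by
        by_cases hl : l' = l
        · subst hl
          simp only [if_true]
          exact Or.inr (by convert hneg using 1; ring)
        · simp [hl]) l (by simp only [if_true]; convert hneg using 1; ring)
    refine ⟨t, ht, C, hC, fun π T => (M.sum_expectHist_mono π T fun n _ h => ?_).trans (h π T)⟩
    rw [score, Finset.sum_eq_single l]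
    · simp only [if_true]
      refine le_of_eq ?_
      congr 3
      ring
    · intro l' _ hl
      simp [hl]
    · simp
  obtain ⟨t, ht, C, hC, hup⟩ := hex 1
  obtain ⟨t', ht', C', hC', hdn⟩ := hex (-1)
  refine ⟨min t t' * (c / 2), by positivity, C + C', add_nonneg hC hC', fun π T x => ?_⟩
  rw [← div_le_iff₀ (Real.exp_pos _), div_eq_inv_mul, ← Real.exp_neg, neg_neg]
  refine le_trans ?_ (add_le_add (hup π T) (hdn π T))
  rw [← M.sum_expectHist_add, ← M.sum_expectHist_const_mul]
  refine M.sum_expectHist_mono π T fun n _ h => ?_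
  rw [← mul_add, mul_left_comm]
  refine mul_le_mul_of_nonneg_left ?_ (playProb_nonneg π h l k)
  split_ifs with hdev
  swap
  · rw [mul_zero]
    positivity
  obtain ⟨hx, hdev⟩ := hdev
  set N : ℝ := (count h k l : ℝ) with hN
  set S : ℝ := (clicks h k l : ℝ) with hS
  have hN0 : 0 ≤ N := Nat.cast_nonneg _
  have hSN : S / N * N = S := by
    rcases eq_or_ne N 0 with h0 | h0
    · have h2 : S ≤ N := Nat.cast_le.2 (clicks_le_count h k l)
      have h3 : 0 ≤ S := Nat.cast_nonneg _
      rw [h0, mul_zero]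
      linarith
    · exact div_mul_cancel₀ _ h0
  have key : ∀ u v : ℝ, 0 < u → min t t' ≤ u → c / 2 * N ≤ v →
      Real.exp (min t t' * (c / 2) * x) ≤ Real.exp (u * v) := by
    intro u v hu hmin hv
    refine Real.exp_le_exp.2 ?_
    have hm : 0 ≤ min t t' := le_min ht.le ht'.le
    calc min t t' * (c / 2) * x ≤ min t t' * (c / 2 * N) := by
          rw [mul_assoc]; gcongr
      _ ≤ u * v := mul_le_mul hmin hv (by positivity) hu.le
  rw [mul_one]
  rcases le_abs'.1 hdev with hlo | hhi
  · have h1 := key t' (-1 * (S - M.κ l * M.θ k * N) - c / 2 * N) ht' (min_le_right _ _)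
      (by nlinarith)
    linarith [Real.exp_pos (t * (1 * (S - M.κ l * M.θ k * N) - c / 2 * N))]
  · have h1 := key t (1 * (S - M.κ l * M.θ k * N) - c / 2 * N) ht (min_le_left _ _)
      (by nlinarith)
    linarith [Real.exp_pos (t' * (-1 * (S - M.κ l * M.θ k * N) - c / 2 * N))]

open Classical in
-- The log-likelihood ratio of `x` against the true parameter has drift −d(κ_l θ_k, κ_l x) < 0 at
-- each position.
theorem Model.exists_sum_playProb_armLik_le (M : Model K L) (k : Fin K) (l : Fin L) {x : ℝ}
    (hx : M.θ k < x) (hx1 : x < 1) :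
    ∃ C ≥ 0, ∀ (π : Policy K L) (T : ℕ),
      ∑ n ∈ Finset.range T, M.expectHist π n (fun h => playProb π h l k *
        (if armLik M.κ h k (M.θ k) ≤ armLik M.κ h k x then 1 else 0)) ≤ C := by
  have hx0 := (M.θ_pos k).trans hx
  have hneg : ∀ l, M.κ l * M.θ k * Real.log (M.κ l * x / (M.κ l * M.θ k)) +
      (1 - M.κ l * M.θ k) * Real.log ((1 - M.κ l * x) / (1 - M.κ l * M.θ k)) < 0 := fun l => by
    have hq := mul_mem_openUnit M.κ_mem hx0 hx1 l
    have hk := kl_pos (M.prob_pos k l) (M.prob_lt_one k l) hq.1 hq.2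
      (mul_lt_mul_of_pos_left hx (M.κ_pos l)).ne
    rw [kl, ← inv_div, Real.log_inv, ← inv_div (1 - M.κ l * x), Real.log_inv] at hk
    linarith
  obtain ⟨t, ht, C, hC, h⟩ := M.exists_sum_playProb_mul_exp_score_le k
    (fun l => Real.log (M.κ l * x / (M.κ l * M.θ k)))
    (fun l => Real.log ((1 - M.κ l * x) / (1 - M.κ l * M.θ k)))
    (fun l => Or.inr (hneg l)) l (hneg l)
  refine ⟨C, hC, fun π T => (M.sum_expectHist_mono π T fun n _ h => ?_).trans (h π T)⟩
  refine mul_le_mul_of_nonneg_left ?_ (playProb_nonneg π h l k)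
  split_ifs with hlik
  · exact Real.one_le_exp (mul_nonneg ht.le
      (score_log_nonneg h k M.κ_mem (M.θ_pos k) (M.θ_lt_one k) hx0 hx1 hlik))
  · exact (Real.exp_pos _).le

open Classical in
/-- How often an arm is shown while its index exceeds a value `x` above its attractiveness. -/
theorem Model.exists_sum_playProb_index_le (M : Model K L) (k : Fin K) (l : Fin L) {x : ℝ}
    (hx : M.θ k < x) (hx1 : x < 1) :
    ∃ C ≥ 0, ∀ ε > 0, ∃ C₂ ≥ (0 : ℝ), ∃ β > (0 : ℝ), ∀ (π : Policy K L) (T : ℕ), 1 ≤ T →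
      ∑ n ∈ Finset.range T, M.expectHist π n (fun h => playProb π h l k *
        (if x < index M.κ h k ((1 + ε) * Real.log ((n : ℝ) + 1)) then 1 else 0)) ≤
      (1 + ε) ^ 2 * Real.log T / kl (M.κ l * M.θ k) (M.κ l * x) + C +
        C₂ / (T : ℝ) ^ β := by
  have hx0 := (M.θ_pos k).trans hx
  have hq := mul_mem_openUnit M.κ_mem hx0 hx1 l
  have hp0 := M.prob_pos k l
  have hp1 := M.prob_lt_one k l
  obtain ⟨C, hC, hlik⟩ := M.exists_sum_playProb_armLik_le k l hx hx1
  refine ⟨C + 2, by linarith, fun ε hε => ?_⟩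
  set d := kl (M.κ l * M.θ k) (M.κ l * x) with hd
  have hd0 : 0 < d := kl_pos hp0 hp1 hq.1 hq.2 (mul_lt_mul_of_pos_left hx (M.κ_pos l)).ne
  have hε1 : 0 < 1 + ε := by linarith
  have hlt : d / (1 + ε) < d := div_lt_self hd0 (by linarith)
  -- Frequencies within `c` of the truth have divergence larger than d/(1+ε).
  obtain ⟨c, hc, hclose⟩ := Metric.eventually_nhds_iff.1
    ((continuousAt_kl_left hp0 hp1 hq.1 hq.2).eventually (lt_mem_nhds hlt))
  obtain ⟨t, ht, C₂, hC₂, hfreq⟩ := M.exists_sum_playProb_freq_le k l hc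
  refine ⟨C₂, hC₂, t * ((1 + ε) ^ 2 / d), by positivity, fun π T hT => ?_⟩
  have hT1 : (1 : ℝ) ≤ T := by exact_mod_cast hT
  have hT0 : (0 : ℝ) < T := by linarith
  have hlogT : 0 ≤ Real.log T := Real.log_nonneg hT1
  -- Chosen so that N₀ · d/(1+ε) = (1+ε) log T, an upper bound for the threshold in all the rounds;
  -- the choice of β makes e^{−tN₀} = T^{−β}.
  set N₀ := (1 + ε) ^ 2 * Real.log T / d with hN₀
  have hN₀0 : 0 ≤ N₀ := by positivity
  have e : C₂ * Real.exp (-(t * N₀)) = C₂ / (T : ℝ) ^ (t * ((1 + ε) ^ 2 / d)) := by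
    rw [div_eq_mul_inv, ← Real.rpow_neg hT0.le, Real.rpow_def_of_pos hT0]
    congr 2
    rw [hN₀]
    ring
  -- With N₀ + 1 instead of N₀, the complementary case has count strictly above N₀, as the strict
  -- inequality below needs.
  have hcount := M.sum_playProb_count_lt_le π k l (x := N₀ + 1) (by linarith) T
  have hsum := add_le_add (add_le_add hcount (hlik π T)) (hfreq π T N₀)
  rw [e, ← M.sum_expectHist_add, ← M.sum_expectHist_add] at hsum
  refine le_trans (M.sum_expectHist_mono π T fun n hn h => ?_) (hsum.trans (by linarith))
  rw [← mul_add, ← mul_add]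
  refine mul_le_mul_of_nonneg_left ?_ (playProb_nonneg π h l k)
  by_cases hidx : x < index M.κ h k ((1 + ε) * Real.log ((n : ℝ) + 1))
  swap
  · rw [if_neg hidx]
    exact add_nonneg (add_nonneg (ite_one_zero_nonneg _) (ite_one_zero_nonneg _))
      (ite_one_zero_nonneg _)
  rw [if_pos hidx]
  by_cases h1 : (count h k l : ℝ) < N₀ + 1
  · rw [if_pos h1]
    exact le_add_of_le_of_nonneg (le_add_of_nonneg_right (ite_one_zero_nonneg _))
      (ite_one_zero_nonneg _)
  by_cases h2 : armLik M.κ h k (M.θ k) ≤ armLik M.κ h k x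
  · rw [if_pos h2]
    exact le_add_of_le_of_nonneg (le_add_of_nonneg_left (ite_one_zero_nonneg _))
      (ite_one_zero_nonneg _)
  rw [if_neg h1, if_neg h2, zero_add, zero_add, if_pos]
  rw [not_lt] at h1
  refine ⟨by linarith, ?_⟩
  by_contra hcon
  have hklb := hclose (y := (clicks h k l : ℝ) / count h k l)
    (by rw [Real.dist_eq]; exact not_le.1 hcon)
  have hn1 : (0 : ℝ) < (n : ℝ) + 1 := by positivity
  have hlogn : 0 ≤ Real.log ((n : ℝ) + 1) :=
    Real.log_nonneg (by linarith [Nat.cast_nonneg (α := ℝ) n])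
  have hdiv := (of_lt_index h k M.κ_mem hx0.le hx1.le hidx).resolve_left
    fun hall => h2 (hall _ (M.θ_pos k).le hx.le)
  have hle := count_mul_kl_le h k M.κ_mem hx0 hx1 (by positivity) hdiv l
  have hlogle : Real.log ((n : ℝ) + 1) ≤ Real.log T :=
    Real.log_le_log hn1 (by exact_mod_cast hn)
  have hgt : N₀ * (d / (1 + ε)) <
      (count h k l : ℝ) * kl ((clicks h k l : ℝ) / count h k l) (M.κ l * x) :=
    mul_lt_mul'' (by linarith) hklb hN₀0 (by positivity)
  have hN₀d : N₀ * (d / (1 + ε)) = (1 + ε) * Real.log T := by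
    rw [hN₀]
    field_simp
  have := mul_le_mul_of_nonneg_left hlogle hε1.le
  linarith

/-! ### One round of the algorithm -/

section Round

variable {hL : 1 ≤ L} {κ : Fin L → ℝ} {ε : ℝ} {init : Fin K → Action K L}
  {lead : (n : ℕ) → Hist K L n → Action K L}

/-- The arms that PBM-PIE may explore after the record `h`. -/
abbrev pieCandidates (hL : 1 ≤ L) (κ : Fin L → ℝ) (ε : ℝ)
    (lead : (n : ℕ) → Hist K L n → Action K L) (h : Hist K L n) : Finset (Fin K) :=
  candidates hL κ h (lead n h) ((1 + ε) * Real.log ((n : ℝ) + 1))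

theorem expect_pbmPie_of_empty (hn : K ≤ n) (h : Hist K L n)
    (hB : ¬ (pieCandidates hL κ ε lead h).Nonempty) (f : Action K L → ℝ) :
    expect (pbmPie hL κ ε init lead n h) f = f (lead n h) := by
  rw [pbmPie, dif_neg (not_lt.2 hn), dif_neg hB, expect_pure]

theorem expect_pbmPie_of_nonempty (hn : K ≤ n) (h : Hist K L n)
    (hB : (pieCandidates hL κ ε lead h).Nonempty) (f : Action K L → ℝ) :
    expect (pbmPie hL κ ε init lead n h) f =
      1 / 2 * (((pieCandidates hL κ ε lead h).card : ℝ)⁻¹ *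
        ∑ k ∈ pieCandidates hL κ ε lead h, f (Function.update (lead n h) (lastPos hL) k)) +
      1 / 2 * f (lead n h) := by
  rw [pbmPie, dif_neg (not_lt.2 hn), dif_pos hB, expect_bind, expect_bern]
  simp only [if_true, expect_map, expect_uniformOfFinset, Bool.false_eq_true, if_false,
    expect_pure]
  norm_num

theorem expect_pbmPie_mono (hn : K ≤ n) (h : Hist K L n) {f g : Action K L → ℝ}
    (hlead : f (lead n h) ≤ g (lead n h))
    (hcand : ∀ k ∈ pieCandidates hL κ ε lead h,
      f (Function.update (lead n h) (lastPos hL) k) ≤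
        g (Function.update (lead n h) (lastPos hL) k)) :
    expect (pbmPie hL κ ε init lead n h) f ≤ expect (pbmPie hL κ ε init lead n h) g := by
  by_cases hB : (pieCandidates hL κ ε lead h).Nonempty
  · rw [expect_pbmPie_of_nonempty hn h hB, expect_pbmPie_of_nonempty hn h hB]
    have := Finset.sum_le_sum hcand
    gcongr
  · rwa [expect_pbmPie_of_empty hn h hB, expect_pbmPie_of_empty hn h hB]

theorem half_le_playProb_lead (hn : K ≤ n) (h : Hist K L n) (l : Fin L) :
    1 / 2 ≤ playProb (pbmPie hL κ ε init lead) h l (lead n h l) := by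
  rw [playProb]
  by_cases hB : (pieCandidates hL κ ε lead h).Nonempty
  · rw [expect_pbmPie_of_nonempty hn h hB, if_pos rfl, mul_one]
    refine le_add_of_nonneg_left (mul_nonneg (by norm_num) (mul_nonneg (by positivity)
      (Finset.sum_nonneg fun k _ => ite_one_zero_nonneg _)))
  · rw [expect_pbmPie_of_empty hn h hB, if_pos rfl]
    norm_num

theorem le_playProb_of_mem_candidates (hn : K ≤ n) (h : Hist K L n) {k : Fin K}
    (hk : k ∈ pieCandidates hL κ ε lead h) :
    1 / (2 * (K : ℝ)) ≤ playProb (pbmPie hL κ ε init lead) h (lastPos hL) k := by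
  have hB : (pieCandidates hL κ ε lead h).Nonempty := ⟨k, hk⟩
  rw [playProb, expect_pbmPie_of_nonempty hn h hB]
  have hcard : ((pieCandidates hL κ ε lead h).card : ℝ) ≤ K := by
    have := Finset.card_le_univ (pieCandidates hL κ ε lead h)
    rw [Fintype.card_fin] at this
    exact_mod_cast this
  have hpos : (0 : ℝ) < (pieCandidates hL κ ε lead h).card := by
    exact_mod_cast Finset.card_pos.2 hB
  have hone := Finset.single_le_sum (f := fun k' =>
    if Function.update (lead n h) (lastPos hL) k' (lastPos hL) = k then (1 : ℝ) else 0)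
    (fun k' _ => ite_one_zero_nonneg _) hk
  simp only [Function.update_self, if_true] at hone
  simp only [Function.update_self]
  have h1 : 1 / (2 * (K : ℝ)) = 1 / 2 * ((K : ℝ)⁻¹ * 1) := by
    rw [mul_one, one_div, mul_inv, one_div]
  rw [h1]
  refine le_add_of_le_of_nonneg ?_ (mul_nonneg (by norm_num) (ite_one_zero_nonneg _))
  gcongr

end Round

/-! ### The regret of PBM-PIE -/

/-- The last arm of the optimal action. -/
abbrev lastArm (hL : 1 ≤ L) (hLK : L ≤ K) : Fin K := Fin.castLE hLK (lastPos hL)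

theorem mem_range_optAction (hLK : L ≤ K) (k : Fin K) :
    k ∈ Set.range (optAction hLK) ↔ k.val < L :=
  ⟨by rintro ⟨l, rfl⟩; exact l.isLt, fun h => ⟨⟨k, h⟩, rfl⟩⟩

theorem Model.mean_nonneg (M : Model K L) (a : Action K L) : 0 ≤ M.mean a :=
  Finset.sum_nonneg fun l _ => (M.prob_pos (a l) l).le

theorem Model.gap_le (M : Model K L) (hLK : L ≤ K) (a : Action K L) :
    M.gap hLK a ≤ M.mean (optAction hLK) :=
  sub_le_self _ (M.mean_nonneg a)

theorem Model.gap_update (M : Model K L) (hL : 1 ≤ L) (hLK : L ≤ K) (k : Fin K) :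
    M.gap hLK (Function.update (optAction hLK) (lastPos hL) k) =
      M.κ (lastPos hL) * (M.θ (lastArm hL hLK) - M.θ k) := by
  rw [Model.gap, Model.mean, Model.mean, ← Finset.sum_sub_distrib,
    Finset.sum_eq_single (lastPos hL)]
  · rw [Function.update_self, mul_sub]
    rfl
  · intro l _ hl
    rw [Function.update_of_ne hl, sub_self]
  · simp

/-- Consecutive attractivenesses differ by more than `2 η`. -/
def Model.Separated (M : Model K L) (η : ℝ) : Prop :=
  ∀ (k : ℕ) (hk : k + 1 < K),
    η < (M.θ ⟨k, Nat.lt_of_succ_lt hk⟩ - M.θ ⟨k + 1, hk⟩) / 2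

theorem Model.Separated.lt_sub {M : Model K L} {η : ℝ} (hη : M.Separated η) {i j : Fin K}
    (hij : i < j) : 2 * η < M.θ i - M.θ j := by
  have hi : i.val + 1 < K := by
    have := j.isLt
    have : i.val < j.val := hij
    omega
  have h1 := hη i.val hi
  have h2 : M.θ j ≤ M.θ ⟨i.val + 1, hi⟩ := M.θ_anti.antitone (show i.val + 1 ≤ j.val from hij)
  have h3 : M.θ ⟨i.val, Nat.lt_of_succ_lt hi⟩ = M.θ i := rfl
  linarith

/-- If the leaders are well estimated but are not the best arms in order, then one of the best
arms is not a leader and is badly estimated, and the last leader is estimated below its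
attractiveness. -/
theorem Model.exists_bad_arm (M : Model K L) (hL : 1 ≤ L) (hLK : L ≤ K) {η : ℝ} (hη0 : 0 < η)
    (hη : M.Separated η) {lead : (n : ℕ) → Hist K L n → Action K L}
    (hlead : IsLeaderRule M.κ lead) (h : Hist K L n)
    (hgood : ∀ l, |estimate M.κ h (lead n h l) - M.θ (lead n h l)| < η / 2)
    (hne : lead n h ≠ optAction hLK) :
    ∃ k, k ∉ Set.range (lead n h) ∧ η / 2 ≤ |estimate M.κ h k - M.θ k| ∧
      estimate M.κ h (lead n h (lastPos hL)) ≤ M.θ k := by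
  obtain ⟨hinj, hord, hout⟩ := hlead n h
  -- Errors below η/2 cannot reverse arms that are 2η apart. Both lists are thus increasing, and
  -- differ only if their sets of arms differ.
  have hmono : StrictMono (lead n h) := by
    intro i j hij
    by_contra hcon
    have hlt : lead n h j < lead n h i :=
      lt_of_le_of_ne (not_lt.1 hcon) fun he => hij.ne' (hinj he)
    have h1 := hη.lt_sub hlt
    have h2 := abs_lt.1 (hgood i)
    have h3 := abs_lt.1 (hgood j)
    linarith [hord i j hij]
  have hopt : StrictMono (optAction hLK) := fun i j hij => hij
  have himg : Finset.univ.image (lead n h) ≠ Finset.univ.image (optAction hLK) := by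
    intro he
    refine hne ((hmono.range_inj hopt).1 ?_)
    have := congrArg (fun s : Finset (Fin K) => (s : Set (Fin K))) he
    simpa using this
  have hcard : (Finset.univ.image (lead n h)).card = (Finset.univ.image (optAction hLK)).card := by
    rw [Finset.card_image_of_injective _ hinj, Finset.card_image_of_injective _ hopt.injective]
  obtain ⟨k, hk, hkl⟩ := Finset.not_subset.1 fun hs =>
    himg (Finset.eq_of_subset_of_card_le hs hcard.le).symm
  obtain ⟨k', hk', hkl'⟩ := Finset.not_subset.1 fun hs =>
    himg (Finset.eq_of_subset_of_card_le hs hcard.ge)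
  obtain ⟨j, -, rfl⟩ := Finset.mem_image.1 hk'
  have hkr : k ∉ Set.range (lead n h) := by
    rintro ⟨l, rfl⟩
    exact hkl (Finset.mem_image_of_mem _ (Finset.mem_univ l))
  have hkL : k.val < L := by
    obtain ⟨l, -, rfl⟩ := Finset.mem_image.1 hk
    exact l.isLt
  have hjL : ¬ (lead n h j).val < L := fun hlt => by
    obtain ⟨l, hl⟩ := (mem_range_optAction hLK _).2 hlt
    exact hkl' (hl ▸ Finset.mem_image_of_mem _ (Finset.mem_univ l))
  have hsep := hη.lt_sub (i := k) (j := lead n h j) (Fin.lt_def.2 (hkL.trans_le (Nat.le_of_not_lt hjL)))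
  have hj := abs_lt.1 (hgood j)
  have hlast : estimate M.κ h (lead n h (lastPos hL)) ≤ estimate M.κ h (lead n h j) := by
    rcases eq_or_ne j (lastPos hL) with rfl | hne'
    · exact le_rfl
    · refine hord _ _ (lt_of_le_of_ne ?_ hne')
      have := j.isLt
      exact Fin.le_def.2 (by simp only [lastPos]; omega)
  refine ⟨k, hkr, ?_, by linarith⟩
  -- The estimate of k is at most that of the leader j, which is below θ_j + η/2 < θ_k − 3η/2.
  have := hout k hkr j
  exact le_abs'.2 (Or.inl (by linarith))

open Classical in
/-- The conditional probabilities of showing a badly estimated arm, added up. -/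
def Model.badPlay (M : Model K L) (η : ℝ) (π : Policy K L) (h : Hist K L n) : ℝ :=
  ∑ k, ∑ l, playProb π h l k * (if η ≤ |estimate M.κ h k - M.θ k| then 1 else 0)

open Classical in
/-- The number of arms for which the confidence bound of level `δ` fails. -/
def Model.badBound (M : Model K L) (δ : ℝ) (h : Hist K L n) : ℝ :=
  ∑ k, if divergence M.κ h k (M.θ k) ≤ ENNReal.ofReal δ then 0 else 1

theorem Model.badPlay_nonneg (M : Model K L) (η : ℝ) (π : Policy K L) (h : Hist K L n) :
    0 ≤ M.badPlay η π h :=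
  Finset.sum_nonneg fun _ _ => Finset.sum_nonneg fun _ _ =>
    mul_nonneg (playProb_nonneg _ _ _ _) (ite_one_zero_nonneg _)

theorem Model.badBound_nonneg (M : Model K L) (δ : ℝ) (h : Hist K L n) : 0 ≤ M.badBound δ h :=
  Finset.sum_nonneg fun k _ => by split_ifs <;> norm_num

theorem Model.playProb_le_badPlay (M : Model K L) {η : ℝ} (π : Policy K L) (h : Hist K L n)
    (k : Fin K) (l : Fin L) (hdev : η ≤ |estimate M.κ h k - M.θ k|) :
    playProb π h l k ≤ M.badPlay η π h := by
  classical
  have hnn : ∀ k l, 0 ≤ playProb π h l k *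
      (if η ≤ |estimate M.κ h k - M.θ k| then 1 else 0) := fun k l =>
    mul_nonneg (playProb_nonneg _ _ _ _) (ite_one_zero_nonneg _)
  refine le_trans ?_ (Finset.single_le_sum (f := fun k => ∑ l, playProb π h l k *
      (if η ≤ |estimate M.κ h k - M.θ k| then 1 else 0))
    (fun k _ => Finset.sum_nonneg fun l _ => hnn k l) (Finset.mem_univ k))
  refine le_trans ?_ (Finset.single_le_sum (fun l _ => hnn k l) (Finset.mem_univ l))
  rw [if_pos hdev, mul_one]

theorem Model.one_le_badBound (M : Model K L) {δ : ℝ} (h : Hist K L n) (k : Fin K)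
    (hk : ¬ divergence M.κ h k (M.θ k) ≤ ENNReal.ofReal δ) : 1 ≤ M.badBound δ h := by
  classical
  refine le_trans (le_of_eq ?_) (Finset.single_le_sum (f := fun k =>
    if divergence M.κ h k (M.θ k) ≤ ENNReal.ofReal δ then (0 : ℝ) else 1)
    (fun k _ => by split_ifs <;> norm_num) (Finset.mem_univ k))
  rw [if_neg hk]

section Regret

variable {ε η : ℝ} {init : Fin K → Action K L} {lead : (n : ℕ) → Hist K L n → Action K L}

/-- When the leaders are not the optimal action, a badly estimated arm is shown with a
probability bounded below, unless a confidence bound fails. -/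
theorem Model.one_le_of_lead_ne (M : Model K L) (hL : 1 ≤ L) (hLK : L ≤ K) (hη0 : 0 < η)
    (hη : M.Separated η) (hlead : IsLeaderRule M.κ lead) (hn : K ≤ n) (h : Hist K L n)
    (hne : lead n h ≠ optAction hLK) :
    1 ≤ 2 * K * M.badPlay (η / 2) (pbmPie hL M.κ ε init lead) h +
      M.badBound ((1 + ε) * Real.log ((n : ℝ) + 1)) h := by
  have hK : (1 : ℝ) ≤ K := by exact_mod_cast hL.trans hLK
  have hb := M.badPlay_nonneg (η / 2) (pbmPie hL M.κ ε init lead) h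
  have hb' := M.badBound_nonneg ((1 + ε) * Real.log ((n : ℝ) + 1)) h
  by_cases hgood : ∀ l, |estimate M.κ h (lead n h l) - M.θ (lead n h l)| < η / 2
  · obtain ⟨k, hk, hdev, hle⟩ := M.exists_bad_arm hL hLK hη0 hη hlead h hgood hne
    by_cases hdiv : divergence M.κ h k (M.θ k) ≤
        ENNReal.ofReal ((1 + ε) * Real.log ((n : ℝ) + 1))
    · have hmem : k ∈ pieCandidates hL M.κ ε lead h := by
        simp only [pieCandidates, candidates, Finset.mem_filter, Finset.mem_univ, true_and]
        exact ⟨hk, hle.trans (le_index h k M.κ_mem (M.θ_lt_one k).le hdiv)⟩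
      have h1 := (le_playProb_of_mem_candidates (init := init) hn h hmem).trans
        (M.playProb_le_badPlay _ h k (lastPos hL) hdev)
      rw [div_le_iff₀ (by positivity)] at h1
      linarith
    · have := M.one_le_badBound h k hdiv
      have : 0 ≤ 2 * K * M.badPlay (η / 2) (pbmPie hL M.κ ε init lead) h := by positivity
      linarith
  · push Not at hgood
    obtain ⟨l, hl⟩ := hgood
    have h1 := (half_le_playProb_lead (hL := hL) (κ := M.κ) (ε := ε) (init := init)
      (lead := lead) hn h l).trans (M.playProb_le_badPlay _ h _ l hl)
    nlinarith

open Classical in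
/-- The conditional expected regret of a round in which the leaders are the optimal action. -/
theorem Model.expect_gap_le_of_lead_eq (M : Model K L) (hL : 1 ≤ L) (hLK : L ≤ K)
    (hn : K ≤ n) (h : Hist K L n) (heq : lead n h = optAction hLK) :
    expect (pbmPie hL M.κ ε init lead n h) (M.gap hLK) ≤
      ∑ k : Fin K with L ≤ k.val, M.κ (lastPos hL) * (M.θ (lastArm hL hLK) - M.θ k) *
        (2 * K * M.badPlay (η / 2) (pbmPie hL M.κ ε init lead) h +
          playProb (pbmPie hL M.κ ε init lead) h (lastPos hL) k *
          (if M.θ (lastArm hL hLK) - η < index M.κ h k ((1 + ε) * Real.log ((n : ℝ) + 1))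
            then 1 else 0)) := by
  set π := pbmPie hL M.κ ε init lead with hπ
  have hw : ∀ k : Fin K, L ≤ k.val →
      0 ≤ M.κ (lastPos hL) * (M.θ (lastArm hL hLK) - M.θ k) := fun k hk =>
    mul_nonneg (M.κ_pos _).le (sub_nonneg.2 (M.θ_anti.antitone
      (Fin.le_def.2 ((show L - 1 ≤ L by omega).trans hk))))
  have h1 : expect (π n h) (M.gap hLK) ≤ expect (π n h) fun a =>
      ∑ k : Fin K with L ≤ k.val, M.κ (lastPos hL) * (M.θ (lastArm hL hLK) - M.θ k) *
        ((if a (lastPos hL) = k then 1 else 0) *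
          (if k ∈ pieCandidates hL M.κ ε lead h then 1 else 0)) := by
    refine expect_pbmPie_mono hn h ?_ fun k hk => ?_
    · rw [heq, Model.gap, sub_self]
      refine Finset.sum_nonneg fun k hk => mul_nonneg (hw k (Finset.mem_filter.1 hk).2)
        (mul_nonneg (ite_one_zero_nonneg _) (ite_one_zero_nonneg _))
    · have hkL : L ≤ k.val := by
        have hk' := hk
        simp only [pieCandidates, candidates, Finset.mem_filter, Finset.mem_univ, true_and,
          heq, mem_range_optAction, not_lt] at hk'
        exact hk'.1
      rw [heq, M.gap_update hL hLK k]
      refine le_trans (le_of_eq ?_) (Finset.single_le_sum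
        (fun k hk => mul_nonneg (hw k (Finset.mem_filter.1 hk).2)
          (mul_nonneg (ite_one_zero_nonneg _) (ite_one_zero_nonneg _)))
        (Finset.mem_filter.2 ⟨Finset.mem_univ k, hkL⟩))
      rw [Function.update_self, if_pos rfl, if_pos hk, mul_one, mul_one]
  refine h1.trans ?_
  rw [expect_sum]
  refine Finset.sum_le_sum fun k hk => ?_
  rw [expect_const_mul, expect_mul_const]
  refine mul_le_mul_of_nonneg_left ?_ (hw k (Finset.mem_filter.1 hk).2)
  change playProb π h (lastPos hL) k * _ ≤ _
  have hK : (1 : ℝ) ≤ K := by exact_mod_cast hL.trans hLK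
  have hb := M.badPlay_nonneg (η / 2) π h
  have hp0 := playProb_nonneg π h (lastPos hL) k
  by_cases hmem : k ∈ pieCandidates hL M.κ ε lead h
  swap
  · rw [if_neg hmem, mul_zero]
    exact add_nonneg (by positivity) (mul_nonneg hp0 (ite_one_zero_nonneg _))
  rw [if_pos hmem, mul_one]
  by_cases hdev : η / 2 ≤ |estimate M.κ h (lastArm hL hLK) - M.θ (lastArm hL hLK)|
  -- A badly estimated arm L is shown as last leader with probability at least 1/2, so the `badPlay`
  -- term alone is at least 1.
  · have h2 := half_le_playProb_lead (hL := hL) (κ := M.κ) (ε := ε) (init := init)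
      (lead := lead) hn h (lastPos hL)
    rw [heq] at h2
    have h3 := h2.trans (M.playProb_le_badPlay π h (lastArm hL hLK) (lastPos hL) hdev)
    refine le_add_of_le_of_nonneg ?_ (mul_nonneg hp0 (ite_one_zero_nonneg _))
    have := playProb_le_one π h (lastPos hL) k
    nlinarith
  · have h2 := (abs_lt.1 (not_le.1 hdev)).1
    have hidx : M.θ (lastArm hL hLK) - η <
        index M.κ h k ((1 + ε) * Real.log ((n : ℝ) + 1)) := by
      simp only [pieCandidates, candidates, Finset.mem_filter, Finset.mem_univ, true_and,
        heq] at hmem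
      have h3 : estimate M.κ h (lastArm hL hLK) ≤
        index M.κ h k ((1 + ε) * Real.log ((n : ℝ) + 1)) := hmem.2
      have hη0 : 0 < η := by
        have := abs_nonneg (estimate M.κ h (lastArm hL hLK) - M.θ (lastArm hL hLK))
        linarith [not_le.1 hdev]
      linarith
    rw [if_pos hidx, mul_one]
    exact le_add_of_nonneg_left (by positivity)

/-! ### Summing over the rounds. -/

theorem Model.exists_sum_badPlay_le (M : Model K L) (hη0 : 0 < η) :
    ∃ C ≥ 0, ∀ (π : Policy K L) (T : ℕ),
      ∑ n ∈ Finset.range T, M.expectHist π n (M.badPlay η π) ≤ C := by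
  choose C hC h using fun k l => M.exists_sum_playProb_estimate_le k l hη0
  refine ⟨∑ k, ∑ l, C k l, Finset.sum_nonneg fun k _ => Finset.sum_nonneg fun l _ => hC k l,
    fun π T => ?_⟩
  unfold Model.badPlay
  rw [M.sum_expectHist_sum]
  refine Finset.sum_le_sum fun k _ => ?_
  rw [M.sum_expectHist_sum]
  exact Finset.sum_le_sum fun l _ => h k l π T

theorem Model.exists_sum_badBound_le (M : Model K L) (hε : 0 < ε) :
    ∃ C ≥ 0, ∀ (π : Policy K L) (T : ℕ),
      ∑ n ∈ Finset.range T, M.expectHist π n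
        (M.badBound ((1 + ε) * Real.log ((n : ℝ) + 1))) ≤ C := by
  choose C hC h using fun k => M.exists_sum_prob_divergence_le k hε
  refine ⟨∑ k, C k, Finset.sum_nonneg fun k _ => hC k, fun π T => ?_⟩
  unfold Model.badBound
  rw [M.sum_expectHist_sum]
  exact Finset.sum_le_sum fun k _ => h k π T

end Regret

/-- The leading coefficient of the regret bound, without the factor `(1 + ε) ^ 2`. -/
def Model.rate (M : Model K L) (hL : 1 ≤ L) (hLK : L ≤ K) (η : ℝ) : ℝ :=
  ∑ k : Fin K with L ≤ k.val, M.κ (lastPos hL) * (M.θ (lastArm hL hLK) - M.θ k) /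
    kl (M.κ (lastPos hL) * M.θ k) (M.κ (lastPos hL) * (M.θ (lastArm hL hLK) - η))

/-- The order of quantifiers makes `C₁` independent of ε. The confidence failures are left as a sum
because their bound depends on ε but not on η; it will become the third constant. -/
theorem Model.exists_expRegret_le (M : Model K L) (hL : 1 ≤ L) (hLK : L ≤ K) {η : ℝ}
    (hη0 : 0 < η) (hη : M.Separated η) :
    ∃ C₁ ≥ 0, ∀ ε > 0, ∃ C₂ ≥ (0 : ℝ), ∃ β > (0 : ℝ),
      ∀ (init : Fin K → Action K L) (lead : (n : ℕ) → Hist K L n → Action K L),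
        IsLeaderRule M.κ lead → ∀ T : ℕ, 1 ≤ T →
        M.expRegret hLK (pbmPie hL M.κ ε init lead) T ≤
          (1 + ε) ^ 2 * Real.log T * M.rate hL hLK η + C₁ + C₂ / (T : ℝ) ^ β +
          M.mean (optAction hLK) * ∑ n ∈ Finset.range T,
            M.expectHist (pbmPie hL M.κ ε init lead) n
              (M.badBound ((1 + ε) * Real.log ((n : ℝ) + 1))) := by
  classical
  set G := M.mean (optAction hLK) with hG
  have hG0 : 0 ≤ G := M.mean_nonneg _
  set w : Fin K → ℝ := fun k => M.κ (lastPos hL) * (M.θ (lastArm hL hLK) - M.θ k) with hw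
  set x := M.θ (lastArm hL hLK) - η with hx
  obtain ⟨CQ, hCQ, hQ⟩ := M.exists_sum_badPlay_le (half_pos hη0)
  have hlt : ∀ k : Fin K, L ≤ k.val → M.θ k < x := fun k hk => by
    have := hη.lt_sub (i := lastArm hL hLK) (j := k)
      (Fin.lt_def.2 (lt_of_lt_of_le (show L - 1 < L by omega) hk))
    linarith
  have hw0 : ∀ k : Fin K, L ≤ k.val → 0 ≤ w k := fun k hk =>
    mul_nonneg (M.κ_pos _).le (by linarith [hlt k hk])
  have hx1 : x < 1 := by linarith [M.θ_lt_one (lastArm hL hLK)]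
  have hex : ∀ k : Fin K, ∃ C ≥ 0, ∀ ε > 0, ∃ C₂ ≥ (0 : ℝ), ∃ β > (0 : ℝ), L ≤ k.val →
      ∀ (π : Policy K L) (T : ℕ), 1 ≤ T →
      ∑ n ∈ Finset.range T, M.expectHist π n (fun h => playProb π h (lastPos hL) k *
        (if x < index M.κ h k ((1 + ε) * Real.log ((n : ℝ) + 1)) then 1 else 0)) ≤
      (1 + ε) ^ 2 * Real.log T / kl (M.κ (lastPos hL) * M.θ k) (M.κ (lastPos hL) * x) + C +
        C₂ / (T : ℝ) ^ β := by
    intro k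
    by_cases hk : L ≤ k.val
    · obtain ⟨C, hC, h⟩ := M.exists_sum_playProb_index_le k (lastPos hL) (hlt k hk) hx1
      refine ⟨C, hC, fun ε hε => ?_⟩
      obtain ⟨C₂, hC₂, β, hβ, h'⟩ := h ε hε
      exact ⟨C₂, hC₂, β, hβ, fun _ => h'⟩
    · exact ⟨0, le_rfl, fun ε _ => ⟨0, le_rfl, 1, one_pos, fun hk' => absurd hk' hk⟩⟩
  choose C hC hex using hex
  -- The three terms pay for the initialization, for wrong leaders, and for exploration under
  -- optimal leaders beyond its logarithmic part.
  refine ⟨G * K + G * (2 * K * CQ) +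
    ∑ k : Fin K with L ≤ k.val, w k * (2 * K * CQ + C k), ?_, fun ε hε => ?_⟩
  · refine add_nonneg (by positivity) (Finset.sum_nonneg fun k hk =>
      mul_nonneg (hw0 k (Finset.mem_filter.1 hk).2) (add_nonneg (by positivity) (hC k)))
  choose C₂ hC₂ β hβ hex using fun k => hex k ε hε
  have : Nonempty (Fin K) := ⟨lastArm hL hLK⟩
  -- As T ≥ 1, the smallest exponent serves all arms.
  obtain ⟨k₀, hk₀⟩ := Finite.exists_min β
  refine ⟨∑ k : Fin K with L ≤ k.val, w k * C₂ k, Finset.sum_nonneg fun k hk =>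
    mul_nonneg (hw0 k (Finset.mem_filter.1 hk).2) (hC₂ k), β k₀, hβ k₀,
    fun init lead hlead T hT => ?_⟩
  set π := pbmPie hL M.κ ε init lead with hπ
  have hT1 : (1 : ℝ) ≤ T := by exact_mod_cast hT
  have hround : ∀ n < T, ∀ h : Hist K L n, expect (π n h) (M.gap hLK) ≤
      G * (if n < K then 1 else 0) + (G * (2 * K * M.badPlay (η / 2) π h) +
        (G * M.badBound ((1 + ε) * Real.log ((n : ℝ) + 1)) h +
        ∑ k : Fin K with L ≤ k.val, w k * (2 * K * M.badPlay (η / 2) π h +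
          playProb π h (lastPos hL) k *
          (if x < index M.κ h k ((1 + ε) * Real.log ((n : ℝ) + 1)) then 1 else 0)))) := by
    intro n _ h
    have hle : expect (π n h) (M.gap hLK) ≤ G :=
      (expect_mono fun a => M.gap_le hLK a).trans_eq (expect_const _ _)
    have h1 : 0 ≤ 2 * K * M.badPlay (η / 2) π h :=
      mul_nonneg (by positivity) (M.badPlay_nonneg _ _ _)
    have h2 := M.badBound_nonneg ((1 + ε) * Real.log ((n : ℝ) + 1)) h
    have h3 : 0 ≤ ∑ k : Fin K with L ≤ k.val, w k * (2 * K * M.badPlay (η / 2) π h +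
          playProb π h (lastPos hL) k *
          (if x < index M.κ h k ((1 + ε) * Real.log ((n : ℝ) + 1)) then 1 else 0)) :=
      Finset.sum_nonneg fun k hk => mul_nonneg (hw0 k (Finset.mem_filter.1 hk).2)
        (add_nonneg h1 (mul_nonneg (playProb_nonneg _ _ _ _) (ite_one_zero_nonneg _)))
    have h4 := mul_nonneg hG0 h1
    have h5 := mul_nonneg hG0 h2
    by_cases hn : n < K
    · rw [if_pos hn]
      linarith
    rw [if_neg hn, mul_zero, zero_add]
    by_cases heq : lead n h = optAction hLK
    · have := M.expect_gap_le_of_lead_eq (ε := ε) (η := η) (init := init) hL hLK (not_lt.1 hn) h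
        heq
      linarith
    · have h6 := M.one_le_of_lead_ne (ε := ε) (init := init) hL hLK hη0 hη hlead (not_lt.1 hn) h
        heq
      have h7 := mul_le_mul_of_nonneg_left h6 hG0
      rw [mul_one, mul_add] at h7
      linarith
  rw [M.expRegret_eq_sum]
  refine (M.sum_expectHist_mono π T hround).trans ?_
  rw [M.sum_expectHist_add, M.sum_expectHist_add, M.sum_expectHist_add,
    M.sum_expectHist_const_mul, M.sum_expectHist_const_mul, M.sum_expectHist_const_mul,
    M.sum_expectHist_const_mul, M.sum_expectHist_sum]
  have hinit : ∑ n ∈ Finset.range T, M.expectHist π n (fun _ => if n < K then 1 else 0) ≤ K := by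
    simp only [Model.expectHist, expect_const]
    rw [Finset.sum_ite, Finset.sum_const_zero, add_zero, Finset.sum_const, nsmul_eq_mul, mul_one]
    have hs : (Finset.range T).filter (fun n => n < K) ⊆ Finset.range K := fun n hn =>
      Finset.mem_range.2 (Finset.mem_filter.1 hn).2
    have := Finset.card_le_card hs
    rw [Finset.card_range] at this
    exact_mod_cast this
  have hexplore : ∀ k ∈ Finset.univ.filter (fun k : Fin K => L ≤ k.val),
      ∑ n ∈ Finset.range T, M.expectHist π n (fun h => w k *
        (2 * K * M.badPlay (η / 2) π h + playProb π h (lastPos hL) k *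
          (if x < index M.κ h k ((1 + ε) * Real.log ((n : ℝ) + 1)) then 1 else 0))) ≤
      (1 + ε) ^ 2 * Real.log T *
        (w k / kl (M.κ (lastPos hL) * M.θ k) (M.κ (lastPos hL) * x)) +
        w k * (2 * K * CQ + C k) + w k * C₂ k / (T : ℝ) ^ β k₀ := by
    intro k hk
    have hkL := (Finset.mem_filter.1 hk).2
    rw [M.sum_expectHist_const_mul, M.sum_expectHist_add, M.sum_expectHist_const_mul]
    have h1 := hex k hkL π T hT
    have h2 : C₂ k / (T : ℝ) ^ β k ≤ C₂ k / (T : ℝ) ^ β k₀ :=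
      div_le_div_of_nonneg_left (hC₂ k) (Real.rpow_pos_of_pos (by linarith) _)
        (Real.rpow_le_rpow_of_exponent_le hT1 (hk₀ k))
    have h3 : 2 * (K : ℝ) * ∑ n ∈ Finset.range T, M.expectHist π n (M.badPlay (η / 2) π) ≤
        2 * K * CQ := mul_le_mul_of_nonneg_left (hQ π T) (by positivity)
    refine (mul_le_mul_of_nonneg_left (add_le_add h3 (h1.trans (add_le_add le_rfl h2)))
      (hw0 k hkL)).trans_eq ?_
    ring
  refine (add_le_add (mul_le_mul_of_nonneg_left hinit hG0) (add_le_add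
    (mul_le_mul_of_nonneg_left (mul_le_mul_of_nonneg_left (hQ π T)
      (by positivity : (0 : ℝ) ≤ 2 * K)) hG0)
    (add_le_add le_rfl (Finset.sum_le_sum hexplore)))).trans_eq ?_
  rw [Finset.sum_add_distrib, Finset.sum_add_distrib, ← Finset.mul_sum, ← Finset.sum_div,
    Model.rate]
  ring

/-- A regret bound with separate constants for `η` and `ε`. -/
theorem Model.exists_expRegret_le_add (M : Model K L) (hL : 1 ≤ L) (hLK : L ≤ K) :
    ∃ (C₁ : ℝ → ℝ) (C₂ : ℝ → ℝ → ℝ) (C₃ : ℝ → ℝ) (β : ℝ → ℝ → ℝ),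
      ∀ ε η : ℝ, 0 < ε → 0 < η → M.Separated η → 0 < β ε η ∧
        ∀ (init : Fin K → Action K L) (lead : (n : ℕ) → Hist K L n → Action K L),
          IsLeaderRule M.κ lead → ∀ T : ℕ, 1 ≤ T →
            M.expRegret hLK (pbmPie hL M.κ ε init lead) T ≤
              (1 + ε) ^ 2 * Real.log T * M.rate hL hLK η +
                C₁ η + C₂ ε η / (T : ℝ) ^ β ε η + C₃ ε := by
  choose C₁ hC₁ hC₂ using fun (η : ℝ) (hη0 : 0 < η) (hη : M.Separated η) =>
    M.exists_expRegret_le hL hLK hη0 hη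
  choose C₂ _ β hβ hreg using hC₂
  choose D hD hbound using fun (ε : ℝ) (hε : 0 < ε) => M.exists_sum_badBound_le (ε := ε) hε
  classical
  -- The chosen constants take proofs of admissibility as arguments; elsewhere the functions get the
  -- value 0.
  refine ⟨fun η => if h : 0 < η ∧ M.Separated η then C₁ η h.1 h.2 else 0,
    fun ε η => if h : (0 < η ∧ M.Separated η) ∧ 0 < ε then C₂ η h.1.1 h.1.2 ε h.2 else 0,
    fun ε => if h : 0 < ε then M.mean (optAction hLK) * D ε h else 0,
    fun ε η => if h : (0 < η ∧ M.Separated η) ∧ 0 < ε then β η h.1.1 h.1.2 ε h.2 else 0,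
    fun ε η hε hη0 hη => ?_⟩
  simp only [hε, hη0, hη, and_self, dite_true]
  refine ⟨hβ η hη0 hη ε hε, fun init lead hlead T hT => ?_⟩
  refine (hreg η hη0 hη ε hε init lead hlead T hT).trans (add_le_add le_rfl ?_)
  exact mul_le_mul_of_nonneg_left (hbound ε hε _ T) (M.mean_nonneg _)

/-! ### Asymptotics -/

theorem Model.eventually_separated (M : Model K L) :
    ∀ᶠ η in nhdsWithin (0 : ℝ) (Set.Ioi 0), M.Separated η := by
  have h : ∀ᶠ η in nhds (0 : ℝ), ∀ k : Fin K, ∀ hk : k.val + 1 < K,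
      η < (M.θ k - M.θ ⟨k.val + 1, hk⟩) / 2 := by
    refine Filter.eventually_all.2 fun k => ?_
    by_cases hk : k.val + 1 < K
    · have : M.θ ⟨k.val + 1, hk⟩ < M.θ k := M.θ_anti (Fin.lt_def.2 (Nat.lt_succ_self k.val))
      have hpos : 0 < (M.θ k - M.θ ⟨k.val + 1, hk⟩) / 2 := by linarith
      exact (gt_mem_nhds hpos).mono fun η hη _ => hη
    · exact Filter.Eventually.of_forall fun η hk' => absurd hk' hk
  exact (h.filter_mono nhdsWithin_le_nhds).mono fun η hη k hk => hη ⟨k, _⟩ hk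

theorem Model.gap_insertAction_lastPos (M : Model K L) (hL : 1 ≤ L) (hLK : L ≤ K) (k : Fin K) :
    M.gap hLK (insertAction hLK k (lastPos hL)) =
      M.κ (lastPos hL) * (M.θ (lastArm hL hLK) - M.θ k) := by
  rw [← M.gap_update hL hLK k]
  congr 1
  funext j
  rcases eq_or_ne j (lastPos hL) with rfl | hj
  · simp [insertAction]
  · have hlt : j < lastPos hL := by
      have h1 := j.isLt
      have h2 : j.val ≠ L - 1 := fun h => hj (Fin.ext h)
      exact Fin.lt_def.2 (show j.val < L - 1 by omega)
    rw [Function.update_of_ne hj, insertAction, if_pos hlt]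
    rfl

/-- Continuity of the divergence in its second argument; the limiting denominators are positive
because θ_k < θ_L for k > L. -/
theorem Model.tendsto_rate (M : Model K L) (hL : 1 ≤ L) (hLK : L ≤ K) :
    Tendsto (M.rate hL hLK) (nhdsWithin 0 (Set.Ioi 0))
      (nhds (∑ k : Fin K with L ≤ k.val, M.exploreCost hL hLK k (lastPos hL))) := by
  refine Tendsto.mono_left (tendsto_finsetSum _ fun k hk => ?_) nhdsWithin_le_nhds
  have hkL := (Finset.mem_filter.1 hk).2
  have hne : M.κ (lastPos hL) * M.θ k ≠ M.κ (lastPos hL) * M.θ (lastArm hL hLK) :=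
    (mul_lt_mul_of_pos_left (M.θ_anti (Fin.lt_def.2
      (lt_of_lt_of_le (show L - 1 < L by omega) hkL))) (M.κ_pos _)).ne
  have hp0 := M.prob_pos k (lastPos hL)
  have hp1 := M.prob_lt_one k (lastPos hL)
  have hq0 := M.prob_pos (lastArm hL hLK) (lastPos hL)
  have hq1 := M.prob_lt_one (lastArm hL hLK) (lastPos hL)
  rw [Model.exploreCost, M.gap_insertAction_lastPos]
  refine Tendsto.div tendsto_const_nhds ?_ (kl_pos hp0 hp1 hq0 hq1 hne).ne'
  have h1 : Tendsto (fun η : ℝ => M.κ (lastPos hL) * (M.θ (lastArm hL hLK) - η)) (nhds 0)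
      (nhds (M.κ (lastPos hL) * M.θ (lastArm hL hLK))) := by
    have : Continuous fun η : ℝ => M.κ (lastPos hL) * (M.θ (lastArm hL hLK) - η) := by fun_prop
    simpa using this.tendsto 0
  exact (continuousAt_kl_right hp0 hp1 hq0 hq1).tendsto.comp h1

/-- The terms in b and c vanish after division by log T. In `EReal` the upper limit needs no
boundedness condition. -/
theorem limsup_div_log_le {R : ℕ → ℝ} {a b c β : ℝ} (hβ : 0 < β)
    (h : ∀ T : ℕ, 1 ≤ T → R T ≤ a * Real.log T + b + c / (T : ℝ) ^ β) :
    limsup (fun T : ℕ => ((R T / Real.log T : ℝ) : EReal)) atTop ≤ (a : EReal) := by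
  have hlog : Tendsto (fun T : ℕ => Real.log T) atTop atTop :=
    Real.tendsto_log_atTop.comp tendsto_natCast_atTop_atTop
  have hlim : Tendsto (fun T : ℕ => a + (b + |c|) / Real.log T) atTop (nhds a) := by
    simpa using tendsto_const_nhds.add (hlog.const_div_atTop (b + |c|))
  have hE := (continuous_coe_real_ereal.tendsto a).comp hlim
  rw [← hE.limsup_eq]
  refine limsup_le_limsup ?_
  filter_upwards [hlog.eventually_gt_atTop 0, eventually_ge_atTop 1] with T hT hT1
  refine EReal.coe_le_coe_iff.2 ?_
  rw [div_le_iff₀ hT, add_mul, div_mul_cancel₀ _ hT.ne']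
  have hpow : 1 ≤ (T : ℝ) ^ β := Real.one_le_rpow (by exact_mod_cast hT1) hβ.le
  have : c / (T : ℝ) ^ β ≤ |c| := (div_le_div_of_nonneg_right (le_abs_self c)
    (by linarith)).trans (div_le_self (abs_nonneg c) hpow)
  linarith [h T hT1]

end PBM

end

theorem theorem5 {K L : ℕ} (hL : 1 ≤ L) (hLK : L ≤ K) (M : PBM.Model K L) :
    (∃ (C₁ : ℝ → ℝ) (C₂ : ℝ → ℝ → ℝ) (C₃ : ℝ → ℝ) (β : ℝ → ℝ → ℝ),
      ∀ ε η : ℝ, 0 < ε → 0 < η →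
        (∀ (k : ℕ) (hk : k + 1 < K),
          η < (M.θ ⟨k, Nat.lt_of_succ_lt hk⟩ - M.θ ⟨k + 1, hk⟩) / 2) →
        0 < β ε η ∧
        ∀ (init : Fin K → PBM.Action K L)
          (lead : (n : ℕ) → PBM.Hist K L n → PBM.Action K L),
          PBM.IsInit init → PBM.IsLeaderRule M.κ lead →
          ∀ T : ℕ, 1 ≤ T →
            M.expRegret hLK (PBM.pbmPie hL M.κ ε init lead) T ≤
              (1 + ε) ^ 2 * Real.log T *
                (∑ k : Fin K with L ≤ k.val,
                  M.κ (PBM.lastPos hL) *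
                      (M.θ (Fin.castLE hLK (PBM.lastPos hL)) - M.θ k) /
                    PBM.kl (M.κ (PBM.lastPos hL) * M.θ k)
                      (M.κ (PBM.lastPos hL) *
                        (M.θ (Fin.castLE hLK (PBM.lastPos hL)) - η)))
              + C₁ η + C₂ ε η / (T : ℝ) ^ β ε η + C₃ ε) ∧
    ((∀ k : Fin K, L ≤ k.val → ∀ l : Fin L,
        M.exploreCost hL hLK k (PBM.lastPos hL) ≤ M.exploreCost hL hLK k l) →
      ∀ ε : ℝ, 0 < ε →
      ∀ (init : Fin K → PBM.Action K L)
        (lead : (n : ℕ) → PBM.Hist K L n → PBM.Action K L),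
        PBM.IsInit init → PBM.IsLeaderRule M.κ lead →
        limsup (fun T : ℕ =>
            ((M.expRegret hLK (PBM.pbmPie hL M.κ ε init lead) T / Real.log T : ℝ) : EReal))
          atTop ≤
        (((1 + ε) ^ 2 * ∑ k : Fin K with L ≤ k.val,
            ⨅ l : Fin L, M.exploreCost hL hLK k l : ℝ) : EReal)) := by
  obtain ⟨C₁, C₂, C₃, β, hreg⟩ := M.exists_expRegret_le_add hL hLK
  refine ⟨⟨C₁, C₂, C₃, β, fun ε η hε hη0 hη => ⟨(hreg ε η hε hη0 hη).1,
    fun init lead _ hlead T hT => (hreg ε η hε hη0 hη).2 init lead hlead T hT⟩⟩, ?_⟩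
  intro hmin ε hε init lead _ hlead
  have hcost : ∀ k ∈ Finset.univ.filter (fun k : Fin K => L ≤ k.val),
      ⨅ l : Fin L, M.exploreCost hL hLK k l = M.exploreCost hL hLK k (PBM.lastPos hL) := by
    intro k hk
    have : Nonempty (Fin L) := ⟨PBM.lastPos hL⟩
    exact le_antisymm (ciInf_le (Set.finite_range _).bddBelow _)
      (le_ciInf (hmin k (Finset.mem_filter.1 hk).2))
  rw [Finset.sum_congr rfl hcost]
  have hlim := (continuous_coe_real_ereal.tendsto _).comp
    ((M.tendsto_rate hL hLK).const_mul ((1 + ε) ^ 2))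
  -- The upper limit does not depend on η, so its bounds by (1+ε)² times the rate at η, for all
  -- small η > 0, pass to the limit η → 0.
  refine ge_of_tendsto hlim ?_
  filter_upwards [M.eventually_separated, self_mem_nhdsWithin] with η hη hη0
  obtain ⟨hβ, hle⟩ := hreg ε η hε hη0 hη
  refine PBM.limsup_div_log_le (b := C₁ η + C₃ ε) (c := C₂ ε η) hβ fun T hT => ?_
  have := hle init lead hlead T hT
  linarith
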